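/- Let $a,b>0$, let $m^\pm\ge 1$ be integers, let $\eta^\pm\in(-1,1)^{m^\pm}$, and let $\alpha^\pm\in[0,\infty)^{m^\pm}$ satisfy $\sum_{i=1}^{m^\pm}\alpha_i^\pm<1$. Let $X$ be the set of real functions $u\in C^2[-1,1]$ satisfying the multi-point Dirichlet-type conditions $$u(-1)=\sum_{i=1}^{m^-}\alpha_i^-\,u(\eta_i^-),\qquad u(1)=\sum_{i=1}^{m^+}\alpha_i^+\,u(\eta_i^+).$$ With $u^\pm=\max\{\pm u,0\}$, a number $\lambda\in\mathbb R$ is called a half-eigenvalue if there is a function $u\in X$, not identically zero (a half-eigenfunction for $\lambda$), such that $$-u''=\lambda\,(a\,u^+-b\,u^-)\quad\text{on }(-1,1).$$ For an integer $k\ge1$ and a sign $\nu\in\{+,-\}$ (identified with $\pm1$), let $T_{k,\nu}$ be the set of $u\in X$ such that: (a) $u'(\pm1)\ne0$ and $\nu u'(-1)>0$; (b) $u'$ has exactly $k$ zeros in $(-1,1)$, and $u''\neq 0$ at each of them; (c) $u$ has a zero strictly between any two consecutive zeros of $u'$ in $(-1,1)$. Then for each $k\ge1$ and $\nu\in\{\pm\}$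 there is exactly one half-eigenvalue $\lambda_{k,\nu}$ which has a half-eigenfunction $\varphi_{k,\nu}\in T_{k,\nu}$. Moreover $\lambda_{k,\nu}>0$, and there are no half-eigenvalues other than the $\lambda_{k,\nu}$. The half-eigenvalues are strictly increasing in the sense that $$k'>k\implies\lambda_{k',\nu'}>\lambda_{k,\nu}\quad\text{for all }\nu,\nu'\in\{\pm\}.$$ In addition, for each $\nu\in\{\pm\}$, every half-eigenfunction $\varphi_{1,\nu}\in T_{1,\nu}$ for $\lambda_{1,\nu}$ satisfies $\nu\varphi_{1,\nu}>0$ on $(-1,1)$, and $\lim_{k\to\infty}\lambda_{k,\nu}=\infty$. -/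

import Mathlib

open Set Filter

/-- Data of the multi-point Dirichlet-type conditions
`u(±1) = ∑ i, α^±_i u(η^±_i)`: numbers of points, coefficients, and points. -/
structure MultiPointData where
  mMinus : ℕ
  mPlus : ℕ
  alphaMinus : Fin mMinus → ℝ
  alphaPlus : Fin mPlus → ℝ
  etaMinus : Fin mMinus → ℝ
  etaPlus : Fin mPlus → ℝ

/-- The set `A_+^m` of nonnegative coefficient vectors with `∑ |α_i| < 1`. -/
def coeffSetPlus (m : ℕ) : Set (Fin m → ℝ) :=
  {α | (∑ i, |α i|) < 1 ∧ ∀ i, 0 ≤ α i}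

/-- Standing assumptions: `m^± ≥ 1`, `η^±_i ∈ (-1,1)`, `α^± ∈ A_+^{m^±}`. -/
structure MultiPointData.Admissible (D : MultiPointData) : Prop where
  one_le_mMinus : 1 ≤ D.mMinus
  one_le_mPlus : 1 ≤ D.mPlus
  etaMinus_mem : ∀ i, D.etaMinus i ∈ Ioo (-1 : ℝ) 1
  etaPlus_mem : ∀ i, D.etaPlus i ∈ Ioo (-1 : ℝ) 1
  alphaMinus_mem : D.alphaMinus ∈ coeffSetPlus D.mMinus
  alphaPlus_mem : D.alphaPlus ∈ coeffSetPlus D.mPlus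

/-- The derivative `u'` on the closed interval `[-1,1]` (one-sided at the end points). -/
noncomputable def dI (u : ℝ → ℝ) : ℝ → ℝ := derivWithin u (Icc (-1 : ℝ) 1)

/-- The space `X` of `C²` functions on `[-1,1]` that satisfy the multi-point conditions.
A function on `[-1,1]` is represented by any extension to `ℝ`; only its values on `[-1,1]`
matter. -/
def MultiPointData.X (D : MultiPointData) : Set (ℝ → ℝ) :=
  {u | ContDiffOn ℝ 2 u (Icc (-1 : ℝ) 1) ∧
    u (-1) = ∑ i, D.alphaMinus i * u (D.etaMinus i) ∧
    u 1 = ∑ i, D.alphaPlus i * u (D.etaPlus i)}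

/-- `u ∈ X` is a non-trivial solution of `-u'' = lam (a u⁺ - b u⁻)` on `(-1,1)`, where
`u⁺ = max {u, 0}` and `u⁻ = max {-u, 0}`. -/
def MultiPointData.IsHalfEigenfunction (D : MultiPointData) (a b lam : ℝ) (u : ℝ → ℝ) : Prop :=
  u ∈ D.X ∧
  (∃ x ∈ Icc (-1 : ℝ) 1, u x ≠ 0) ∧
  ∀ x ∈ Ioo (-1 : ℝ) 1, -(dI (dI u) x) = lam * (a * max (u x) 0 - b * max (-(u x)) 0)

/-- `lam` (any real number) is a half-eigenvalue. -/
def MultiPointData.IsHalfEigenvalue (D : MultiPointData) (a b lam : ℝ) : Prop :=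
  ∃ u, D.IsHalfEigenfunction a b lam u

/-- The nodal class `T_{k,ν} ⊆ X`; the sign `ν` is a unit `1` or `-1` of `ℤ`. -/
structure MultiPointData.T (D : MultiPointData) (k : ℕ) (ν : ℤˣ) (u : ℝ → ℝ) : Prop where
  mem_X : u ∈ D.X
  deriv_right_ne : dI u 1 ≠ 0
  deriv_left_sign : 0 < ((ν : ℤ) : ℝ) * dI u (-1)
  deriv_zeros_simple : ∀ x ∈ Ioo (-1 : ℝ) 1, dI u x = 0 → dI (dI u) x ≠ 0
  deriv_zeros_card : {x ∈ Ioo (-1 : ℝ) 1 | dI u x = 0}.encard = k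
  zero_between : ∀ x ∈ Ioo (-1 : ℝ) 1, ∀ y ∈ Ioo (-1 : ℝ) 1, x < y →
    dI u x = 0 → dI u y = 0 → (∀ z ∈ Ioo x y, dI u z ≠ 0) → ∃ z ∈ Ioo x y, u z = 0

/-!
The nontrivial solutions of `-u'' = s² (a u⁺ - b u⁻)` with `s > 0` are exactly the functions
`x ↦ C w (s x + θ)` with `C > 0`, where `w` is one fixed periodic function, glued from two sine
arches (`exists_isHalfWave`, `IsHalfWave.exists_eqOn_scaledWave`). For `lam ≤ 0` a maximum principle
excludes nontrivial solutions of the boundary conditions (`MultiPointData.nonpos_of_convex`). So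
half-eigenfunctions correspond to pairs `(s, θ)` for which `w` satisfies one condition at each of
the end phases `θ - s` and `θ + s`.

The critical points of `w` are the multiples `i h` of its half-period `h`; they cut the line into
arcs. Since `w` has constant energy `w'² + a (w⁺)² + b (w⁻)² = 1` and the coefficients are
nonnegative with sum less than one, a multi-point condition holding at an end phase forces `|w'|`
there to exceed the weighted sum of `|w'|` at the inner phases (`IsHalfWave.sum_abs_v_lt`).
In particular end phases are never critical points. Moreover, inside an arc the residual of the
condition, multiplied by the sign of `w'` there, crosses zero only upwards when the end phase moves
forward at least as fast as the inner phases (`IsHalfWave.sign_bdefect_pos_of_move`). This gives,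
for every `s` and every arc, exactly one admissible phase: for the left condition a phase `A i s` that increases with `s`, for
the right one a phase `B j s` that decreases with `s`. Both are continuous and
`A i s - B j s` tends to infinity, while at `s = 0` both are the zero of `w` in the respective arc.
Hence `A i s = B j s` has a positive solution if and only if `i < j`, it is unique, and it grows
strictly when the range of arcs from `i` to `j` grows (`IsHalfWave.exists_pair`,
`IsHalfWave.pair_rigid`, `MultiPointData.IsPair.lt`).

The arcs also encode the nodal class: the parity of `i` is the sign of `u'(-1)`, and `j - i` is the
number of critical points in `(-1, 1)` (`IsHalfWave.mem_T`). By periodicity of `w`, the solution `s`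
depends only on `j - i` and the parity of `i`. Any two ranges of arcs of different lengths can be
nested after a shift by an even number, which is the monotonicity of the half-eigenvalues, and
divergence holds because `2 s` is at least `(k - 1) h`.
-/

/-! ### The model solution -/

/-- Two everywhere differentiable functions that agree to first order at `0` can be glued there. -/
lemma hasDerivAt_ite_zero_le {f g f' g' : ℝ → ℝ} (hf : ∀ t, HasDerivAt f (f' t) t)
    (hg : ∀ t, HasDerivAt g (g' t) t) (h0 : f 0 = g 0) (h0' : f' 0 = g' 0) (t : ℝ) :
    HasDerivAt (fun t => if 0 ≤ t then f t else g t) (if 0 ≤ t then f' t else g' t) t := by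
  rcases lt_trichotomy t 0 with ht | rfl | ht
  · rw [if_neg (not_le.2 ht)]
    refine (hg t).congr_of_eventuallyEq ?_
    filter_upwards [Iio_mem_nhds ht] with x hx
    rw [if_neg (not_le.2 hx)]
  · rw [if_pos le_rfl, ← hasDerivWithinAt_univ, ← Iic_union_Ici (a := (0 : ℝ))]
    refine HasDerivWithinAt.union ?_ ?_
    · rw [h0']
      refine (hg 0).hasDerivWithinAt.congr (fun x hx => ?_) ?_
      · rcases eq_or_lt_of_le (show x ≤ 0 from hx) with rfl | hx
        · simp [h0]
        · rw [if_neg (not_le.2 hx)]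
      · simp [h0]
    · exact (hf 0).hasDerivWithinAt.congr (fun x hx => if_pos hx) (if_pos le_rfl)
  · rw [if_pos ht.le]
    refine (hf t).congr_of_eventuallyEq ?_
    filter_upwards [Ioi_mem_nhds ht] with x hx
    rw [if_pos (le_of_lt hx)]

lemma hasDerivAt_of_periodic {W V : ℝ → ℝ} {P : ℝ} (hP : 0 < P) (hW : Function.Periodic W P)
    (hV : Function.Periodic V P) (h : ∀ t ∈ Ico 0 P, HasDerivAt W (V t) t) (t : ℝ) :
    HasDerivAt W (V t) t := by
  have e : t - toIcoDiv hP 0 t • P = toIcoMod hP 0 t := rfl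
  have h1 := h _ (by simpa using toIcoMod_mem_Ico hP 0 t)
  rw [← e, hV.sub_zsmul_eq] at h1
  have h2 := HasDerivAt.comp t h1 ((hasDerivAt_id t).sub_const (toIcoDiv hP 0 t • P))
  rw [mul_one] at h2
  exact h2.congr_of_eventuallyEq (.of_forall fun x => (hW.sub_zsmul_eq _).symm)

/-- The solution with `u 0 = 0`, `u' 0 = 1` of the equation with `a = c ^ 2`, `b = d ^ 2`, correct
between the neighbouring zeros `-π / d` and `π / c`. -/
noncomputable def kink (c d t : ℝ) : ℝ :=
  if 0 ≤ t then Real.sin (c * t) / c else Real.sin (d * t) / d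

/-- The derivative of `kink`. -/
noncomputable def kinkDeriv (c d t : ℝ) : ℝ :=
  if 0 ≤ t then Real.cos (c * t) else Real.cos (d * t)

/-- The second derivative of `kink`. -/
noncomputable def kinkDeriv2 (c d t : ℝ) : ℝ :=
  if 0 ≤ t then -c * Real.sin (c * t) else -d * Real.sin (d * t)

lemma hasDerivAt_kink {c d : ℝ} (hc : 0 < c) (hd : 0 < d) (t : ℝ) :
    HasDerivAt (kink c d) (kinkDeriv c d t) t := by
  have aux : ∀ c : ℝ, 0 < c → ∀ t, HasDerivAt (fun t => Real.sin (c * t) / c)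
      (Real.cos (c * t)) t := by
    intro c hc t
    have := (((hasDerivAt_id t).const_mul c).sin).div_const c
    simpa [hc.ne'] using this
  exact hasDerivAt_ite_zero_le (aux c hc) (aux d hd) (by simp) (by simp) t

lemma hasDerivAt_kinkDeriv (c d t : ℝ) :
    HasDerivAt (kinkDeriv c d) (kinkDeriv2 c d t) t := by
  have aux : ∀ c : ℝ, ∀ t, HasDerivAt (fun t => Real.cos (c * t)) (-c * Real.sin (c * t)) t := by
    intro c t
    have := (((hasDerivAt_id t).const_mul c).cos)
    simpa [mul_comm] using this
  exact hasDerivAt_ite_zero_le (aux c) (aux d) (by simp) (by simp) t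

/-- The facts about the normalized periodic solution `w` of `-w'' = a w⁺ - b w⁻` on which the
argument rests, with `v = w'`. Time is shifted so that the critical points of `w` are the integer
multiples of the half-period `h`, the minima at the even ones; they are equally spaced because
going from a critical point to the next one takes a quarter period of each of the two sine
functions that make up `w`. -/
structure IsHalfWave (a b h : ℝ) (w v : ℝ → ℝ) : Prop where
  h_pos : 0 < h
  hasDerivAt_w : ∀ t, HasDerivAt w (v t) t
  hasDerivAt_v : ∀ t, HasDerivAt v (-(a * max (w t) 0 - b * max (-(w t)) 0)) t
  energy : ∀ t, v t ^ 2 + a * max (w t) 0 ^ 2 + b * max (-(w t)) 0 ^ 2 = 1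
  periodic_w : Function.Periodic w (2 * h)
  periodic_v : Function.Periodic v (2 * h)
  v_pos : ∀ t ∈ Ioo 0 h, 0 < v t
  v_neg : ∀ t ∈ Ioo h (2 * h), v t < 0
  v_zero : v 0 = 0
  v_h : v h = 0
  w_zero : w 0 < 0
  w_h : 0 < w h

lemma sin_mul_nonneg_of_le {d r : ℝ} (hd : 0 < d) (h0 : 0 ≤ r) (h1 : r ≤ Real.pi / d) :
    0 ≤ Real.sin (d * r) := by
  apply Real.sin_nonneg_of_nonneg_of_le_pi (by positivity)
  rw [le_div_iff₀ hd] at h1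
  linarith

lemma cos_mul_pos_of_lt {d r : ℝ} (hd : 0 < d) (h0 : -(Real.pi / (2 * d)) < r)
    (h1 : r < Real.pi / (2 * d)) : 0 < Real.cos (d * r) := by
  have e : d * (Real.pi / (2 * d)) = Real.pi / 2 := by field_simp
  apply Real.cos_pos_of_mem_Ioo
  constructor <;> nlinarith [mul_lt_mul_of_pos_left h0 hd, mul_lt_mul_of_pos_left h1 hd]

/-- On the interval between its neighbouring zeros, `kink` satisfies the differential equation
and the energy identity. -/
lemma kink_energy {c d t : ℝ} (hc : 0 < c) (hd : 0 < d) (h1 : -(Real.pi / d) ≤ t)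
    (h2 : t ≤ Real.pi / c) :
    kinkDeriv2 c d t = -(c ^ 2 * max (kink c d t) 0 - d ^ 2 * max (-(kink c d t)) 0) ∧
    kinkDeriv c d t ^ 2 + c ^ 2 * max (kink c d t) 0 ^ 2 + d ^ 2 * max (-(kink c d t)) 0 ^ 2
      = 1 := by
  unfold kink kinkDeriv kinkDeriv2
  split_ifs with h
  · have hs := sin_mul_nonneg_of_le hc h h2
    have hs' : 0 ≤ Real.sin (c * t) / c := by positivity
    rw [max_eq_left hs', max_eq_right (by linarith)]
    constructor
    · field_simp
      ring
    · field_simp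
      linarith [Real.sin_sq_add_cos_sq (c * t)]
  · push Not at h
    have hs := sin_mul_nonneg_of_le hd (r := -t) (by linarith) (by linarith)
    rw [mul_neg, Real.sin_neg] at hs
    have hs' : 0 ≤ -(Real.sin (d * t) / d) := by
      rw [← neg_div]; positivity
    rw [max_eq_left hs', max_eq_right (by linarith)]
    constructor
    · field_simp
      ring
    · field_simp
      linarith [Real.sin_sq_add_cos_sq (d * t)]

lemma kink_shift {c d t : ℝ} (hc : 0 < c) (hd : 0 < d) :
    (0 ≤ t → t < Real.pi / c → -kink d c (t - Real.pi / c) = kink c d t) ∧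
    (t < 0 → -(Real.pi / d) < t → -kink d c (t + Real.pi / d) = kink c d t) ∧
    (0 ≤ t → t < Real.pi / c → -kinkDeriv d c (t - Real.pi / c) = kinkDeriv c d t) ∧
    (t < 0 → -(Real.pi / d) < t → -kinkDeriv d c (t + Real.pi / d) = kinkDeriv c d t) := by
  have e1 : c * (t - Real.pi / c) = c * t - Real.pi := by field_simp
  have e2 : d * (t + Real.pi / d) = d * t + Real.pi := by field_simp
  refine ⟨fun h1 h2 => ?_, fun h1 h2 => ?_, fun h1 h2 => ?_, fun h1 h2 => ?_⟩
  · rw [kink, kink, if_pos h1, if_neg (by linarith), e1, Real.sin_sub_pi]; ring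
  · rw [kink, kink, if_pos (by linarith), if_neg (by linarith), e2, Real.sin_add_pi]; ring
  · rw [kinkDeriv, kinkDeriv, if_pos h1, if_neg (by linarith), e1, Real.cos_sub_pi]; ring
  · rw [kinkDeriv, kinkDeriv, if_pos (by linarith), if_neg (by linarith), e2, Real.cos_add_pi]
    ring

lemma exists_isHalfWave {a b : ℝ} (ha : 0 < a) (hb : 0 < b) :
    ∃ (h : ℝ) (w v : ℝ → ℝ), IsHalfWave a b h w v := by
  obtain ⟨c, hc, rfl⟩ : ∃ c : ℝ, 0 < c ∧ a = c ^ 2 :=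
    ⟨√a, Real.sqrt_pos.2 ha, (Real.sq_sqrt ha.le).symm⟩
  obtain ⟨d, hd, rfl⟩ : ∃ d : ℝ, 0 < d ∧ b = d ^ 2 :=
    ⟨√b, Real.sqrt_pos.2 hb, (Real.sq_sqrt hb.le).symm⟩
  have hpc : 0 < Real.pi / c := by positivity
  have hpd : 0 < Real.pi / d := by positivity
  have hpc2 : Real.pi / (2 * c) = Real.pi / c / 2 := by field_simp
  have hpd2 : Real.pi / (2 * d) = Real.pi / d / 2 := by field_simp
  set P := Real.pi / c + Real.pi / d with hPdef
  have hP : 0 < P := by positivity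
  set W : ℝ → ℝ := fun t => -kink d c (toIcoMod hP 0 t - Real.pi / c) with hW
  set V : ℝ → ℝ := fun t => -kinkDeriv d c (toIcoMod hP 0 t - Real.pi / c) with hV
  have hWp : Function.Periodic W P := fun t => by simp [hW]
  have hVp : Function.Periodic V P := fun t => by simp [hV]
  -- Centred at the descending zero `π / c`, one formula covers a whole period.
  have modB : ∀ t ∈ Ico 0 P, toIcoMod hP 0 t = t := fun t ht =>
    (toIcoMod_eq_self hP).2 (by simpa using ht)
  have modA : ∀ t ∈ Ico (-P) 0, toIcoMod hP 0 t = t + P := fun t ht => by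
    rw [← toIcoMod_add_right hP]
    exact modB _ ⟨by linarith [ht.1], by linarith [ht.2]⟩
  have WB : ∀ t ∈ Ico 0 P, W t = -kink d c (t - Real.pi / c) := fun t ht => by
    simp only [hW, modB t ht]
  have VB : ∀ t ∈ Ico 0 P, V t = -kinkDeriv d c (t - Real.pi / c) := fun t ht => by
    simp only [hV, modB t ht]
  have WA : ∀ t ∈ Ioo (-(Real.pi / d)) (Real.pi / c), W t = kink c d t := fun t ht => by
    rcases le_or_gt 0 t with h | h
    · rw [WB t ⟨h, by linarith [ht.2]⟩, (kink_shift hc hd).1 h ht.2]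
    · rw [← (kink_shift hc hd).2.1 h ht.1]
      simp only [hW, modA t ⟨by linarith [ht.1], h⟩]
      congr 2; rw [hPdef]; ring
  have VA : ∀ t ∈ Ioo (-(Real.pi / d)) (Real.pi / c), V t = kinkDeriv c d t := fun t ht => by
    rcases le_or_gt 0 t with h | h
    · rw [VB t ⟨h, by linarith [ht.2]⟩, (kink_shift hc hd).2.2.1 h ht.2]
    · rw [← (kink_shift hc hd).2.2.2 h ht.1]
      simp only [hV, modA t ⟨by linarith [ht.1], h⟩]
      congr 2; rw [hPdef]; ring
  have hen : ∀ t ∈ Ico 0 P, V t ^ 2 + c ^ 2 * max (W t) 0 ^ 2 + d ^ 2 * max (-(W t)) 0 ^ 2 = 1 := by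
    intro t ht
    rw [VB t ht, WB t ht, neg_neg]
    have := (kink_energy hd hc (t := t - Real.pi / c) (by linarith [ht.1])
      (by linarith [ht.2])).2
    linarith
  have hdW : ∀ t, HasDerivAt W (V t) t := by
    refine hasDerivAt_of_periodic hP hWp hVp fun t ht => ?_
    rcases eq_or_lt_of_le ht.1 with rfl | h0
    · have hm : (0 : ℝ) ∈ Ioo (-(Real.pi / d)) (Real.pi / c) := ⟨by linarith, by linarith⟩
      rw [VA 0 hm]
      refine (hasDerivAt_kink hc hd 0).congr_of_eventuallyEq ?_
      filter_upwards [Ioo_mem_nhds hm.1 hm.2] with x hx using WA x hx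
    · rw [VB t ht]
      have := ((hasDerivAt_kink hd hc (t - Real.pi / c)).comp_sub_const t (Real.pi / c)).neg
      refine this.congr_of_eventuallyEq ?_
      filter_upwards [Ioo_mem_nhds h0 ht.2] with x hx using WB x ⟨hx.1.le, hx.2⟩
  have hdV : ∀ t, HasDerivAt V (-(c ^ 2 * max (W t) 0 - d ^ 2 * max (-(W t)) 0)) t := by
    refine hasDerivAt_of_periodic hP hVp (fun t => by simp only [hWp t]) fun t ht => ?_
    rcases eq_or_lt_of_le ht.1 with rfl | h0
    · have hm : (0 : ℝ) ∈ Ioo (-(Real.pi / d)) (Real.pi / c) := ⟨by linarith, by linarith⟩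
      rw [WA 0 hm, ← (kink_energy hc hd hm.1.le hm.2.le).1]
      refine (hasDerivAt_kinkDeriv c d 0).congr_of_eventuallyEq ?_
      filter_upwards [Ioo_mem_nhds hm.1 hm.2] with x hx using VA x hx
    · have e := (kink_energy hd hc (t := t - Real.pi / c) (by linarith)
        (by linarith [ht.2])).1
      have := ((hasDerivAt_kinkDeriv d c (t - Real.pi / c)).comp_sub_const t (Real.pi / c)).neg
      rw [e, neg_neg] at this
      rw [WB t ht, neg_neg, neg_sub]
      refine this.congr_of_eventuallyEq ?_
      filter_upwards [Ioo_mem_nhds h0 ht.2] with x hx using VB x ⟨hx.1.le, hx.2⟩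
  -- The half-period is `P / 2`; the shift by `π / (2 d)` moves a minimum to `0`.
  set q := Real.pi / (2 * d) with hq
  have e2 : 2 * (P / 2) = P := by ring
  refine ⟨P / 2, fun t => W (t - q), fun t => V (t - q), by positivity,
    fun t => (hdW (t - q)).comp_sub_const t q, fun t => (hdV (t - q)).comp_sub_const t q,
    fun t => ?_, ?_, ?_, ?_, ?_, ?_, ?_, ?_, ?_⟩
  · have e : (t - q) - toIcoDiv hP 0 (t - q) • P = toIcoMod hP 0 (t - q) := rfl
    have h1 := hen _ (by simpa using toIcoMod_mem_Ico hP 0 (t - q))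
    rwa [← e, hVp.sub_zsmul_eq, hWp.sub_zsmul_eq] at h1
  · intro t
    rw [e2]
    simpa [sub_add_eq_add_sub] using hWp (t - q)
  · intro t
    rw [e2]
    simpa [sub_add_eq_add_sub] using hVp (t - q)
  · rintro t ⟨h1, h2⟩
    rw [VA _ ⟨by linarith, by linarith⟩, kinkDeriv]
    split_ifs with h
    · exact cos_mul_pos_of_lt hc (by linarith [hpc]) (by linarith)
    · exact cos_mul_pos_of_lt hd (by linarith) (by linarith)
  · rintro t ⟨h1, h2⟩
    rw [VB _ ⟨by linarith, by linarith⟩, kinkDeriv, neg_lt_zero]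
    split_ifs with h
    · exact cos_mul_pos_of_lt hd (by linarith) (by linarith)
    · exact cos_mul_pos_of_lt hc (by linarith) (by linarith)
  · rw [VA _ ⟨by linarith, by linarith⟩, kinkDeriv, if_neg (by linarith), zero_sub, mul_neg,
      Real.cos_neg, show d * q = Real.pi / 2 by rw [hq]; field_simp, Real.cos_pi_div_two]
  · rw [VA _ ⟨by linarith, by linarith⟩, kinkDeriv, if_pos (by linarith),
      show c * (P / 2 - q) = Real.pi / 2 by rw [hq, hPdef]; field_simp; ring,
      Real.cos_pi_div_two]
  · rw [WA _ ⟨by linarith, by linarith⟩, kink, if_neg (by linarith), zero_sub, mul_neg,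
      Real.sin_neg, show d * q = Real.pi / 2 by rw [hq]; field_simp, Real.sin_pi_div_two]
    rw [neg_div]
    have : 0 < 1 / d := by positivity
    linarith
  · rw [WA _ ⟨by linarith, by linarith⟩, kink, if_pos (by linarith),
      show c * (P / 2 - q) = Real.pi / 2 by rw [hq, hPdef]; field_simp; ring,
      Real.sin_pi_div_two]
    positivity

/-! ### Arcs and signs -/

/-- The sign `(-1) ^ i` as a real number. -/
noncomputable def realSign (i : ℤ) : ℝ := ((i.negOnePow : ℤ) : ℝ)

lemma realSign_even (n : ℤ) : realSign (2 * n) = 1 := by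
  simp [realSign, Int.negOnePow_even _ (even_two_mul n)]

lemma realSign_succ (i : ℤ) : realSign (i + 1) = -realSign i := by
  simp [realSign, Int.negOnePow_succ]

lemma realSign_odd (n : ℤ) : realSign (2 * n + 1) = -1 := by
  rw [realSign_succ, realSign_even]

lemma realSign_eq (i : ℤ) : realSign i = 1 ∨ realSign i = -1 := by
  obtain ⟨n, rfl | rfl⟩ := Int.even_or_odd' i
  · exact .inl (realSign_even n)
  · exact .inr (realSign_odd n)

/-- The `i`-th arc: the open interval between the `i`-th critical point and the next one. -/
def arc (h : ℝ) (i : ℤ) : Set ℝ := Ioo (i * h) ((i + 1) * h)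

namespace IsHalfWave

variable {a b h : ℝ} {w v : ℝ → ℝ}

lemma continuous_w (H : IsHalfWave a b h w v) : Continuous w :=
  continuous_iff_continuousAt.2 fun t => (H.hasDerivAt_w t).continuousAt

lemma w_add_int (H : IsHalfWave a b h w v) (t : ℝ) (n : ℤ) : w (t + n * (2 * h)) = w t := by
  have := H.periodic_w.zsmul n t
  rwa [zsmul_eq_mul] at this

lemma v_add_int (H : IsHalfWave a b h w v) (t : ℝ) (n : ℤ) : v (t + n * (2 * h)) = v t := by
  have := H.periodic_v.zsmul n t
  rwa [zsmul_eq_mul] at this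

lemma sign_v_pos (H : IsHalfWave a b h w v) {i : ℤ} {t : ℝ} (ht : t ∈ arc h i) :
    0 < realSign i * v t := by
  obtain ⟨n, rfl | rfl⟩ := Int.even_or_odd' i
  · have := H.v_pos (t - n * (2 * h)) (by
      constructor <;> have := ht.1 <;> have := ht.2 <;> push_cast at * <;> linarith)
    rw [← H.v_add_int _ n, sub_add_cancel] at this
    rwa [realSign_even, one_mul]
  · have := H.v_neg (t - n * (2 * h)) (by
      constructor <;> have := ht.1 <;> have := ht.2 <;> push_cast at * <;> linarith)
    rw [← H.v_add_int _ n, sub_add_cancel] at this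
    rw [realSign_odd]
    linarith

lemma v_int_mul (H : IsHalfWave a b h w v) (i : ℤ) : v (i * h) = 0 := by
  obtain ⟨n, rfl | rfl⟩ := Int.even_or_odd' i
  · rw [← H.v_zero, ← H.v_add_int 0 n]
    congr 1; push_cast; ring
  · rw [← H.v_h, ← H.v_add_int h n]
    congr 1; push_cast; ring

lemma sign_w_int_mul (H : IsHalfWave a b h w v) (i : ℤ) : realSign i * w (i * h) < 0 := by
  obtain ⟨n, rfl | rfl⟩ := Int.even_or_odd' i
  · rw [realSign_even, one_mul, show (((2 * n : ℤ) : ℝ) * h) = 0 + n * (2 * h) by push_cast; ring,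
      H.w_add_int]
    exact H.w_zero
  · rw [realSign_odd, show (((2 * n + 1 : ℤ) : ℝ) * h) = h + n * (2 * h) by push_cast; ring,
      H.w_add_int]
    linarith [H.w_h]

lemma sign_w_succ_mul (H : IsHalfWave a b h w v) (i : ℤ) :
    0 < realSign i * w ((i + 1) * h) := by
  have := H.sign_w_int_mul (i + 1)
  rw [realSign_succ] at this
  push_cast at this
  linarith

lemma exists_zero_mem_arc (H : IsHalfWave a b h w v) (i : ℤ) : ∃ z ∈ arc h i, w z = 0 := by
  obtain ⟨z, hz, h0⟩ := intermediate_value_Ioo (a := (i : ℝ) * h) (b := (i + 1) * h)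
    (by nlinarith [H.h_pos]) (f := fun t => realSign i * w t)
    (continuous_const.mul H.continuous_w).continuousOn ⟨H.sign_w_int_mul i, H.sign_w_succ_mul i⟩
  exact ⟨z, hz, by rcases realSign_eq i with hi | hi <;> simpa [hi] using h0⟩

lemma eq_int_mul_or_mem_arc (H : IsHalfWave a b h w v) (t : ℝ) :
    ∃ i : ℤ, t = i * h ∨ t ∈ arc h i := by
  refine ⟨⌊t / h⌋, ?_⟩
  have h1 := Int.floor_le (t / h)
  have h2 := Int.lt_floor_add_one (t / h)
  rw [le_div_iff₀ H.h_pos] at h1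
  rw [div_lt_iff₀ H.h_pos] at h2
  rcases h1.eq_or_lt with h1 | h1
  · exact .inl h1.symm
  · exact .inr ⟨h1, h2⟩

lemma v_eq_zero_iff (H : IsHalfWave a b h w v) (t : ℝ) : v t = 0 ↔ ∃ i : ℤ, t = i * h := by
  refine ⟨fun ht => ?_, ?_⟩
  · obtain ⟨i, hi | hi⟩ := H.eq_int_mul_or_mem_arc t
    · exact ⟨i, hi⟩
    · have := H.sign_v_pos hi
      simp [ht] at this
  · rintro ⟨i, rfl⟩
    exact H.v_int_mul i

/-- Exchanging the roles of `a` and `b` turns `w` into `-w`, up to half a period. -/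
lemma neg_swap (H : IsHalfWave a b h w v) :
    IsHalfWave b a h (fun t => -w (t + h)) (fun t => -v (t + h)) where
  h_pos := H.h_pos
  hasDerivAt_w t := ((H.hasDerivAt_w (t + h)).comp_add_const t h).neg
  hasDerivAt_v t := by
    have := ((H.hasDerivAt_v (t + h)).comp_add_const t h).neg
    refine HasDerivAt.congr_deriv this ?_
    rw [neg_neg (w _)]
    ring
  energy t := by
    rw [neg_neg]
    linarith [H.energy (t + h)]
  periodic_w t := by
    simp only [add_right_comm t (2 * h) h, H.periodic_w (t + h)]
  periodic_v t := by
    simp only [add_right_comm t (2 * h) h, H.periodic_v (t + h)]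
  v_pos t ht := by
    have := H.v_neg (t + h) ⟨by linarith [ht.1], by linarith [ht.2]⟩
    linarith
  v_neg t ht := by
    have h1 := H.v_pos (t - h) ⟨by linarith [ht.1], by linarith [ht.2]⟩
    have h2 := H.periodic_v (t - h)
    rw [show t - h + 2 * h = t + h by ring] at h2
    linarith
  v_zero := by simp [H.v_h]
  v_h := by
    have := H.periodic_v 0
    rw [show h + h = 0 + 2 * h by ring, this, H.v_zero, neg_zero]
  w_zero := by simp [H.w_h]
  w_h := by
    have := H.periodic_w 0
    rw [show h + h = 0 + 2 * h by ring, this]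
    linarith [H.w_zero]

end IsHalfWave

/-! ### The boundary conditions along an arc -/

/-- The residual of a multi-point condition for a function `w`, with end point `e`, inner points
`x i` and coefficients `α i`. -/
def bdefect {ι : Type*} [Fintype ι] (w : ℝ → ℝ) (α : ι → ℝ) (e : ℝ) (x : ι → ℝ) : ℝ :=
  w e - ∑ i, α i * w (x i)

/-- Points `(X i, Y i)` in the elliptic unit disc with nonnegative
weights of sum less than one have their weighted sum in the open disc. -/
lemma weighted_sum_in_ellipse {ι : Type*} [Fintype ι] {c : ℝ} (hc : 0 ≤ c) {α X Y : ι → ℝ}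
    (hα : ∀ i, 0 ≤ α i) (hα1 : ∑ i, α i < 1) (hXY : ∀ i, Y i ^ 2 + c * X i ^ 2 ≤ 1) :
    (∑ i, α i * Y i) ^ 2 + c * (∑ i, α i * X i) ^ 2 < 1 := by
  set SX := ∑ i, α i * X i with hSX
  set SY := ∑ i, α i * Y i with hSY
  set N := SY ^ 2 + c * SX ^ 2 with hN
  have hA : 0 ≤ ∑ i, α i := Finset.sum_nonneg fun i _ => hα i
  have e : N = ∑ i, α i * (SY * Y i + c * SX * X i) := by
    simp only [mul_add, Finset.sum_add_distrib]
    rw [hN, pow_two, pow_two]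
    nth_rewrite 2 [hSY]
    nth_rewrite 2 [hSX]
    rw [Finset.mul_sum, ← mul_assoc, Finset.mul_sum]
    congr 1 <;> exact Finset.sum_congr rfl fun i _ => by ring
  have h1 : N ≤ ∑ i, α i * ((N + 1) / 2) := by
    nth_rewrite 1 [e]
    refine Finset.sum_le_sum fun i _ => mul_le_mul_of_nonneg_left ?_ (hα i)
    nlinarith [sq_nonneg (SY - Y i), mul_nonneg hc (sq_nonneg (SX - X i)), hXY i]
  rw [← Finset.sum_mul] at h1
  have hN0 : 0 ≤ N := by positivity
  nlinarith

section Boundary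

variable {a b h : ℝ} {w v : ℝ → ℝ} {ι : Type*} [Fintype ι] {α : ι → ℝ}

/-- If a multi-point condition holds at `e` with `w e ≥ 0`, then the slope at `e` dominates the
weighted slopes at the inner points: otherwise the point `(w e, w' e)` of the curve of energy `1`
would be dominated by a sub-convex combination of points of energy at most `1`. -/
lemma IsHalfWave.sum_abs_v_lt_of_nonneg (H : IsHalfWave a b h w v) (ha : 0 < a) (hb : 0 < b)
    (hα : ∀ i, 0 ≤ α i) (hα1 : ∑ i, α i < 1) {e : ℝ} {x : ι → ℝ} (h0 : bdefect w α e x = 0)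
    (he : 0 ≤ w e) : ∑ i, α i * |v (x i)| < |v e| := by
  by_contra! hle
  have h1 := weighted_sum_in_ellipse ha.le hα hα1 (X := fun i => max (w (x i)) 0)
    (Y := fun i => |v (x i)|) fun i => by
      have := H.energy (x i)
      have h2 : 0 ≤ b * max (-(w (x i))) 0 ^ 2 := by positivity
      rw [sq_abs]
      linarith
  have h2 : w e ≤ ∑ i, α i * max (w (x i)) 0 := by
    rw [sub_eq_zero.1 h0]
    exact Finset.sum_le_sum fun i _ => mul_le_mul_of_nonneg_left (le_max_left _ _) (hα i)
  have h3 := H.energy e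
  rw [max_eq_left he, max_eq_right (by linarith), ← sq_abs (v e)] at h3
  have h4 := pow_le_pow_left₀ (abs_nonneg _) hle 2
  have h5 := mul_le_mul_of_nonneg_left (pow_le_pow_left₀ he h2 2) ha.le
  linarith

lemma IsHalfWave.sum_abs_v_lt (H : IsHalfWave a b h w v) (ha : 0 < a) (hb : 0 < b)
    (hα : ∀ i, 0 ≤ α i) (hα1 : ∑ i, α i < 1) {e : ℝ} {x : ι → ℝ} (h0 : bdefect w α e x = 0) :
    ∑ i, α i * |v (x i)| < |v e| := by
  rcases le_total 0 (w e) with he | he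
  · exact H.sum_abs_v_lt_of_nonneg ha hb hα hα1 h0 he
  · have := H.neg_swap.sum_abs_v_lt_of_nonneg hb ha hα hα1 (e := e - h) (x := fun i => x i - h)
      (by
        simp only [bdefect, sub_add_cancel, mul_neg, Finset.sum_neg_distrib] at h0 ⊢
        linarith) (by simpa using he)
    simpa using this

/-- At a positive critical value the residual is positive, since such a value is the maximum. -/
lemma IsHalfWave.bdefect_pos (H : IsHalfWave a b h w v) (ha : 0 < a)
    (hα : ∀ i, 0 ≤ α i) (hα1 : ∑ i, α i < 1) {e : ℝ} {x : ι → ℝ} (hv : v e = 0)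
    (he : 0 < w e) : 0 < bdefect w α e x := by
  have h3 := H.energy e
  rw [max_eq_left he.le, max_eq_right (by linarith), hv] at h3
  have hmax : ∀ t, w t ≤ w e := fun t => by
    by_contra! hlt
    have h4 := H.energy t
    rw [max_eq_left (by linarith), max_eq_right (by linarith)] at h4
    have : w e ^ 2 < w t ^ 2 := by gcongr
    nlinarith [sq_nonneg (v t), mul_lt_mul_of_pos_left this ha]
  have h5 : ∑ i, α i * w (x i) ≤ ∑ i, α i * w e :=
    Finset.sum_le_sum fun i _ => mul_le_mul_of_nonneg_left (hmax _) (hα i)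
  rw [← Finset.sum_mul] at h5
  unfold bdefect
  nlinarith

lemma IsHalfWave.bdefect_neg (H : IsHalfWave a b h w v) (hb : 0 < b)
    (hα : ∀ i, 0 ≤ α i) (hα1 : ∑ i, α i < 1) {e : ℝ} {x : ι → ℝ} (hv : v e = 0)
    (he : w e < 0) : bdefect w α e x < 0 := by
  have := H.neg_swap.bdefect_pos hb hα hα1 (e := e - h) (x := fun i => x i - h)
    (by simpa using hv) (by simpa using he)
  simp only [bdefect, sub_add_cancel, mul_neg, Finset.sum_neg_distrib] at this ⊢
  linarith

lemma IsHalfWave.sign_bdefect_pos (H : IsHalfWave a b h w v) (ha : 0 < a) (hb : 0 < b)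
    (hα : ∀ i, 0 ≤ α i) (hα1 : ∑ i, α i < 1) (i : ℤ) (x : ι → ℝ) :
    0 < realSign i * bdefect w α ((i + 1) * h) x := by
  have h1 := H.sign_w_succ_mul i
  have h2 : v ((i + 1) * h) = 0 := by simpa using H.v_int_mul (i + 1)
  rcases realSign_eq i with hi | hi <;> rw [hi] at h1 ⊢
  · linarith [H.bdefect_pos ha hα hα1 (x := x) h2 (by linarith)]
  · linarith [H.bdefect_neg hb hα hα1 (x := x) h2 (by linarith)]

lemma IsHalfWave.sign_bdefect_neg (H : IsHalfWave a b h w v) (ha : 0 < a) (hb : 0 < b)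
    (hα : ∀ i, 0 ≤ α i) (hα1 : ∑ i, α i < 1) (i : ℤ) (x : ι → ℝ) :
    realSign i * bdefect w α (i * h) x < 0 := by
  have := H.sign_bdefect_pos ha hb hα hα1 (i - 1) x
  have h2 := realSign_succ (i - 1)
  rw [sub_add_cancel] at h2
  push_cast at this
  rw [sub_add_cancel] at this
  rw [h2]
  linarith

end Boundary

/-- A function whose derivative is positive at its zeros stays positive once it is nonnegative. -/
lemma pos_of_deriv_pos_at_zeros {f f' : ℝ → ℝ} {x y : ℝ} (hxy : x < y)
    (hf : ∀ t ∈ Icc x y, HasDerivAt f (f' t) t) (h0 : 0 ≤ f x)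
    (hz : ∀ t ∈ Icc x y, f t = 0 → 0 < f' t) : 0 < f y := by
  have hnn : ∀ t ∈ Icc x y, -f t ≤ 0 := by
    refine image_le_of_deriv_right_lt_deriv_boundary (f' := fun t => -f' t) (B := fun _ => 0)
      (B' := fun _ => 0) (fun t ht => (hf t ht).neg.continuousAt.continuousWithinAt)
      (fun t ht => (hf t (Ico_subset_Icc_self ht)).neg.hasDerivWithinAt) (neg_nonpos.2 h0)
      (fun t => hasDerivAt_const t 0) (fun t ht h => ?_)
    linarith [hz t (Ico_subset_Icc_self ht) (neg_eq_zero.1 h)]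
  have hy : y ∈ Icc x y := right_mem_Icc.2 hxy.le
  refine lt_of_le_of_ne (by linarith [hnn y hy]) fun h => ?_
  have h1 := (hasDerivAt_iff_tendsto_slope.1 (hf y hy)).eventually (lt_mem_nhds (hz y hy h.symm))
  have h2 : ∀ᶠ t in nhdsWithin y (Iio y), 0 < slope f y t :=
    h1.filter_mono (nhdsWithin_mono _ fun t ht => ne_of_lt ht)
  obtain ⟨t, ht, ht'⟩ := (h2.and (Ioo_mem_nhdsLT hxy)).exists
  rw [slope_def_field, ← h, sub_zero, div_pos_iff] at ht
  have := hnn t ⟨ht'.1.le, ht'.2.le⟩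
  rcases ht with ht | ht <;> linarith [ht'.2, ht.1, ht.2]

section Boundary

variable {a b h : ℝ} {w v : ℝ → ℝ} {ι : Type*} [Fintype ι] {α : ι → ℝ}

/-- Moving the end point forward inside an arc, while no inner point moves further than the end
point does, makes the signed residual positive once it is nonnegative. Uniqueness and monotonicity
of the solutions of the boundary conditions all come from here. -/
lemma IsHalfWave.sign_bdefect_pos_of_move (H : IsHalfWave a b h w v) (ha : 0 < a) (hb : 0 < b)
    (hα : ∀ i, 0 ≤ α i) (hα1 : ∑ i, α i < 1) {i : ℤ} {e e' : ℝ} {x x' : ι → ℝ}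
    (he : e ∈ arc h i) (he' : e' ∈ arc h i) (hlt : e < e') (hx : ∀ k, |x' k - x k| ≤ e' - e)
    (h0 : 0 ≤ realSign i * bdefect w α e x) : 0 < realSign i * bdefect w α e' x' := by
  set f : ℝ → ℝ := fun t => realSign i *
    bdefect w α (e + t * (e' - e)) (fun k => x k + t * (x' k - x k)) with hf
  have key : 0 < f 1 := by
    refine pos_of_deriv_pos_at_zeros (x := 0) (f' := fun t => realSign i *
      (v (e + t * (e' - e)) * (e' - e) - ∑ k, α k * (v (x k + t * (x' k - x k)) * (x' k - x k))))
      one_pos (fun t _ => ?_) (by simpa [hf] using h0) (fun t ht hz => ?_)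
    · have path : ∀ p q : ℝ, HasDerivAt (fun t => w (p + t * q)) (v (p + t * q) * q) t := by
        intro p q
        have h1 : HasDerivAt (fun t : ℝ => p + t * q) q t := by
          simpa using ((hasDerivAt_id t).mul_const q).const_add p
        exact (H.hasDerivAt_w _).comp t h1
      refine HasDerivAt.const_mul _ ((path _ _).sub ?_)
      exact HasDerivAt.fun_sum fun k _ => (path _ _).const_mul _
    · have hmem : e + t * (e' - e) ∈ arc h i := by
        constructor
        · nlinarith [he.1, ht.1]
        · nlinarith [he'.2, ht.2]
      have hs := H.sign_v_pos hmem
      have hz' : bdefect w α (e + t * (e' - e)) (fun k => x k + t * (x' k - x k)) = 0 := by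
        rcases realSign_eq i with hi | hi <;> simpa [hf, hi] using hz
      have hlt' := H.sum_abs_v_lt ha hb hα hα1 hz'
      have habs : |realSign i| = 1 := by rcases realSign_eq i with hi | hi <;> simp [hi]
      have hve : |v (e + t * (e' - e))| = realSign i * v (e + t * (e' - e)) := by
        rw [← abs_of_pos hs, abs_mul, habs, one_mul]
      have hsum : |realSign i * ∑ k, α k * (v (x k + t * (x' k - x k)) * (x' k - x k))| ≤
          (∑ k, α k * |v (x k + t * (x' k - x k))|) * (e' - e) := by
        rw [abs_mul, habs, one_mul, Finset.sum_mul]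
        refine (Finset.abs_sum_le_sum_abs _ _).trans (Finset.sum_le_sum fun k _ => ?_)
        rw [abs_mul, abs_mul, abs_of_nonneg (hα k), mul_assoc]
        exact mul_le_mul_of_nonneg_left (mul_le_mul_of_nonneg_left (hx k) (abs_nonneg _)) (hα k)
      have := le_abs_self
        (realSign i * ∑ k, α k * (v (x k + t * (x' k - x k)) * (x' k - x k)))
      have h6 := mul_lt_mul_of_pos_right hlt' (sub_pos.2 hlt)
      rw [hve] at h6
      rw [mul_sub]
      linarith
  simpa [hf] using key

/-- For given `s` and `ε`, the residual vanishes for some phase `θ` for which the end point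
`θ + ε s` lies in the `i`-th arc. -/
lemma IsHalfWave.exists_phase (H : IsHalfWave a b h w v) (ha : 0 < a) (hb : 0 < b)
    (hα : ∀ i, 0 ≤ α i) (hα1 : ∑ i, α i < 1) (i : ℤ) (ε : ℝ) (η : ι → ℝ) (s : ℝ) :
    ∃ θ, θ + ε * s ∈ arc h i ∧ bdefect w α (θ + ε * s) (fun k => θ + s * η k) = 0 := by
  have hc : Continuous fun t => realSign i * bdefect w α t (fun k => t - ε * s + s * η k) := by
    unfold bdefect
    have := H.continuous_w
    fun_prop
  obtain ⟨t, ht, h0⟩ := intermediate_value_Ioo (a := (i : ℝ) * h) (b := (i + 1) * h)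
    (by nlinarith [H.h_pos]) hc.continuousOn
    ⟨H.sign_bdefect_neg ha hb hα hα1 i _, H.sign_bdefect_pos ha hb hα hα1 i _⟩
  refine ⟨t - ε * s, by rwa [sub_add_cancel], ?_⟩
  rw [sub_add_cancel]
  rcases realSign_eq i with hi | hi <;> simpa [hi] using h0

lemma IsHalfWave.continuous_phase (H : IsHalfWave a b h w v) (ha : 0 < a) (hb : 0 < b)
    (hα : ∀ i, 0 ≤ α i) (hα1 : ∑ i, α i < 1) {i : ℤ} {ε : ℝ} {η : ι → ℝ} {E : ℝ → ℝ}
    (hE : ∀ s, E s + ε * s ∈ arc h i ∧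
      bdefect w α (E s + ε * s) (fun k => E s + s * η k) = 0) : Continuous E := by
  have hw := H.continuous_w
  -- In the phase variable the signed residual is negative before the zero and positive after it.
  have move : ∀ {s θ θ' : ℝ}, θ + ε * s ∈ arc h i → θ' + ε * s ∈ arc h i → θ < θ' →
      0 ≤ realSign i * bdefect w α (θ + ε * s) (fun k => θ + s * η k) →
      0 < realSign i * bdefect w α (θ' + ε * s) (fun k => θ' + s * η k) := by
    intro s θ θ' h1 h2 hlt h0
    refine H.sign_bdefect_pos_of_move ha hb hα hα1 h1 h2 (by linarith) (fun k => ?_) h0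
    rw [show θ' + s * η k - (θ + s * η k) = θ' - θ by ring, abs_of_pos (by linarith)]
    linarith
  have cont : ∀ l : ℝ, Continuous fun s =>
      realSign i * bdefect w α (l + ε * s) (fun k => l + s * η k) := fun l => by
    unfold bdefect
    fun_prop
  have evarc : ∀ {l s : ℝ}, l + ε * s ∈ arc h i → ∀ᶠ s' in nhds s, l + ε * s' ∈ arc h i := by
    intro l s hl
    have : Continuous fun s' : ℝ => l + ε * s' := by fun_prop
    exact this.continuousAt.eventually (isOpen_Ioo.mem_nhds hl)
  refine continuous_iff_continuousAt.2 fun s => tendsto_order.2 ⟨fun l hl => ?_, fun r hr => ?_⟩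
  · set l' := max l ((E s + (i * h - ε * s)) / 2) with hl'
    have harc := (hE s).1
    have hlt : l' < E s := max_lt hl (by linarith [harc.1])
    have hmem : l' + ε * s ∈ arc h i :=
      ⟨by linarith [harc.1, le_max_right l ((E s + (i * h - ε * s)) / 2)],
        by linarith [harc.2]⟩
    have hneg : realSign i * bdefect w α (l' + ε * s) (fun k => l' + s * η k) < 0 := by
      by_contra! hge
      have := move hmem harc hlt hge
      rw [(hE s).2, mul_zero] at this
      exact lt_irrefl _ this
    filter_upwards [(cont l').continuousAt.eventually (gt_mem_nhds hneg), evarc hmem]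
      with s' h1 h2
    have hle : l ≤ l' := le_max_left _ _
    refine hle.trans_lt ?_
    by_contra! hge
    rcases hge.eq_or_lt with heq | hlt'
    · rw [← heq, (hE s').2, mul_zero] at h1
      exact lt_irrefl _ h1
    · exact lt_asymm h1 (move (hE s').1 h2 hlt' (by rw [(hE s').2, mul_zero]))
  · set r' := min r ((E s + ((i + 1) * h - ε * s)) / 2) with hr'
    have harc := (hE s).1
    have hlt : E s < r' := lt_min hr (by linarith [harc.2])
    have hmem : r' + ε * s ∈ arc h i :=
      ⟨by linarith [harc.1],
        by linarith [harc.2, min_le_right r ((E s + ((i + 1) * h - ε * s)) / 2)]⟩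
    have hpos := move harc hmem hlt (by rw [(hE s).2, mul_zero])
    filter_upwards [(cont r').continuousAt.eventually (lt_mem_nhds hpos), evarc hmem]
      with s' h1 h2
    have hle : r' ≤ r := min_le_left _ _
    refine lt_of_lt_of_le ?_ hle
    by_contra! hge
    rcases hge.eq_or_lt with heq | hlt'
    · rw [heq, (hE s').2, mul_zero] at h1
      exact lt_irrefl _ h1
    · have := move h2 (hE s').1 hlt' h1.le
      rw [(hE s').2, mul_zero] at this
      exact lt_irrefl _ this

end Boundary

/-! ### Admissible pairs of frequency and phase -/

/-- `x ↦ w (s x + θ)` satisfies both multi-point conditions, and its end phases `θ ∓ s` lie in the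
arcs number `i` and `j`. -/
structure MultiPointData.IsPair (D : MultiPointData) (w : ℝ → ℝ) (h : ℝ) (i j : ℤ) (s θ : ℝ) :
    Prop where
  left_mem : θ - s ∈ arc h i
  right_mem : θ + s ∈ arc h j
  left_eq : bdefect w D.alphaMinus (θ - s) (fun k => θ + s * D.etaMinus k) = 0
  right_eq : bdefect w D.alphaPlus (θ + s) (fun k => θ + s * D.etaPlus k) = 0

lemma coeffSetPlus.sum_lt_one {m : ℕ} {α : Fin m → ℝ} (hα : α ∈ coeffSetPlus m) :
    ∑ i, α i < 1 :=
  (Finset.sum_le_sum fun i _ => le_abs_self (α i)).trans_lt hα.1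

section Pairs

variable {a b h : ℝ} {w v : ℝ → ℝ} {D : MultiPointData}

lemma MultiPointData.IsPair.shift (H : IsHalfWave a b h w v) {i j : ℤ} {s θ : ℝ}
    (hp : D.IsPair w h i j s θ) (n : ℤ) :
    D.IsPair w h (i + 2 * n) (j + 2 * n) s (θ + n * (2 * h)) where
  left_mem := by
    constructor <;> have := hp.left_mem.1 <;> have := hp.left_mem.2 <;> push_cast <;> linarith
  right_mem := by
    constructor <;> have := hp.right_mem.1 <;> have := hp.right_mem.2 <;> push_cast <;> linarith
  left_eq := by
    have := hp.left_eq
    simp only [bdefect] at this ⊢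
    simpa only [add_right_comm _ ((n : ℝ) * (2 * h)), add_sub_right_comm, H.w_add_int] using this
  right_eq := by
    have := hp.right_eq
    simp only [bdefect] at this ⊢
    simpa only [add_right_comm _ ((n : ℝ) * (2 * h)), H.w_add_int] using this

/-- The left condition determines the phase as a nondecreasing function of the arc and of `s`,
strictly so in `s`. -/
lemma IsHalfWave.phase_le_of_left (H : IsHalfWave a b h w v) (hD : D.Admissible) (ha : 0 < a)
    (hb : 0 < b) {i j i' j' : ℤ} {s θ s' θ' : ℝ} (hp : D.IsPair w h i j s θ)
    (hp' : D.IsPair w h i' j' s' θ') (hi : i' ≤ i) (hs : s' ≤ s) :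
    θ' ≤ θ ∧ (θ' = θ → i' = i ∧ s' = s) := by
  rcases hi.lt_or_eq with hi | rfl
  · have h1 : ((i' : ℝ) + 1) * h ≤ i * h :=
      mul_le_mul_of_nonneg_right (by exact_mod_cast hi) H.h_pos.le
    have : θ' < θ := by linarith [hp.left_mem.1, hp'.left_mem.2]
    exact ⟨this.le, fun h => absurd h this.ne⟩
  · -- If `θ ≤ θ'`, the end point would have to move from `θ - s` forward to `θ' - s'`.
    by_cases hlt : θ - s < θ' - s' ∧ θ ≤ θ'
    · exfalso
      have := H.sign_bdefect_pos_of_move ha hb hD.alphaMinus_mem.2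
        (coeffSetPlus.sum_lt_one hD.alphaMinus_mem) hp.left_mem hp'.left_mem hlt.1
        (x := fun k => θ + s * D.etaMinus k) (x' := fun k => θ' + s' * D.etaMinus k) (fun k => ?_)
        (by rw [hp.left_eq, mul_zero])
      · rw [hp'.left_eq, mul_zero] at this
        exact lt_irrefl _ this
      · have := hD.etaMinus_mem k
        rw [abs_le]
        constructor <;> nlinarith [this.1, this.2]
    · rw [not_and_or, not_lt, not_le] at hlt
      refine ⟨?_, fun h => ⟨rfl, ?_⟩⟩ <;> rcases hlt with hlt | hlt <;> linarith

lemma IsHalfWave.phase_le_of_right (H : IsHalfWave a b h w v) (hD : D.Admissible) (ha : 0 < a)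
    (hb : 0 < b) {i j i' j' : ℤ} {s θ s' θ' : ℝ} (hp : D.IsPair w h i j s θ)
    (hp' : D.IsPair w h i' j' s' θ') (hj : j ≤ j') (hs : s' ≤ s) :
    θ ≤ θ' ∧ (θ' = θ → j' = j) := by
  rcases hj.lt_or_eq with hj | rfl
  · have h1 : ((j : ℝ) + 1) * h ≤ j' * h :=
      mul_le_mul_of_nonneg_right (by exact_mod_cast hj) H.h_pos.le
    have : θ < θ' := by linarith [hp.right_mem.2, hp'.right_mem.1]
    exact ⟨this.le, fun h => absurd h this.ne'⟩
  · refine ⟨?_, fun _ => rfl⟩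
    by_contra! hlt
    have := H.sign_bdefect_pos_of_move ha hb hD.alphaPlus_mem.2
      (coeffSetPlus.sum_lt_one hD.alphaPlus_mem) hp'.right_mem hp.right_mem (by linarith)
      (x := fun k => θ' + s' * D.etaPlus k) (x' := fun k => θ + s * D.etaPlus k) (fun k => ?_)
      (by rw [hp'.right_eq, mul_zero])
    · rw [hp.right_eq, mul_zero] at this
      exact lt_irrefl _ this
    · have := hD.etaPlus_mem k
      rw [abs_le]
      constructor <;> nlinarith [this.1, this.2]

/-- Enlarging the range of arcs strictly increases the frequency: the left condition makes the
phase nondecreasing in `s`, the right one makes it nonincreasing. -/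
lemma IsHalfWave.pair_rigid (H : IsHalfWave a b h w v) (hD : D.Admissible) (ha : 0 < a)
    (hb : 0 < b) {i j i' j' : ℤ} {s θ s' θ' : ℝ} (hp : D.IsPair w h i j s θ)
    (hp' : D.IsPair w h i' j' s' θ') (hi : i' ≤ i) (hj : j ≤ j') (hs : s' ≤ s) :
    i' = i ∧ j' = j ∧ s' = s := by
  have h1 := H.phase_le_of_left hD ha hb hp hp' hi hs
  have h2 := H.phase_le_of_right hD ha hb hp hp' hj hs
  have e := le_antisymm h1.1 h2.1
  exact ⟨(h1.2 e).1, h2.2 e, (h1.2 e).2⟩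

lemma IsHalfWave.exists_pair (H : IsHalfWave a b h w v) (hD : D.Admissible) (ha : 0 < a)
    (hb : 0 < b) {i j : ℤ} (hij : i < j) : ∃ s θ, 0 < s ∧ D.IsPair w h i j s θ := by
  have hm := hD.alphaMinus_mem
  have hq := hD.alphaPlus_mem
  choose A hA using fun s => H.exists_phase ha hb hm.2 (coeffSetPlus.sum_lt_one hm) i (-1)
    D.etaMinus s
  choose B hB using fun s => H.exists_phase ha hb hq.2 (coeffSetPlus.sum_lt_one hq) j 1
    D.etaPlus s
  have hAc := H.continuous_phase ha hb hm.2 (coeffSetPlus.sum_lt_one hm) hA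
  have hBc := H.continuous_phase ha hb hq.2 (coeffSetPlus.sum_lt_one hq) hB
  have hij' : (i : ℝ) + 1 ≤ j := by exact_mod_cast hij
  have hh := H.h_pos
  -- Beyond this frequency the end phases are too far apart for the arcs `i` and `j`.
  set S := (j + 1 - i) * h / 2 with hS
  have hSpos : 0 < S := by
    have : (0 : ℝ) < j + 1 - i := by linarith
    positivity
  obtain ⟨s, hs, h0⟩ := intermediate_value_Ioo (a := (0 : ℝ)) (b := S) hSpos.le
    (f := fun s => A s - B s) (hAc.sub hBc).continuousOn (show (0 : ℝ) ∈ Ioo _ _ from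
      ⟨by
        have h1 := (hA 0).1.2
        have h2 := (hB 0).1.1
        have := mul_le_mul_of_nonneg_right hij' hh.le
        simp only [mul_zero, add_zero] at h1 h2
        linarith,
      by
        have h1 := (hA S).1.1
        have h2 := (hB S).1.2
        linarith⟩)
  have e : B s = A s := by
    simp only at h0
    linarith
  have h1 := hA s
  have h2 := hB s
  rw [show A s + -1 * s = A s - s by ring] at h1
  rw [e, one_mul] at h2
  exact ⟨s, A s, hs.1, h1.1, h2.1, h1.2, h2.2⟩

/-- A pair with positive frequency spans at least two arcs; compare with `s = 0`. -/
lemma MultiPointData.IsPair.lt (H : IsHalfWave a b h w v) (hD : D.Admissible) (ha : 0 < a)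
    (hb : 0 < b) {i j : ℤ} {s θ : ℝ} (hs : 0 < s) (hp : D.IsPair w h i j s θ) : i < j := by
  have h1 := hp.left_mem.1
  have h2 := hp.right_mem.2
  have hij : (i : ℝ) < j + 1 := lt_of_mul_lt_mul_right (by linarith) H.h_pos.le
  have hij' : i < j + 1 := by exact_mod_cast hij
  refine lt_of_le_of_ne (by omega) ?_
  rintro rfl
  obtain ⟨z, hz, hwz⟩ := H.exists_zero_mem_arc i
  have hpz : D.IsPair w h i i 0 z :=
    ⟨by rwa [sub_zero], by rwa [add_zero], by simp [bdefect, hwz], by simp [bdefect, hwz]⟩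
  have := (H.pair_rigid hD ha hb hp hpz le_rfl le_rfl hs.le).2.2
  exact hs.ne this

end Pairs

/-! ### Reduction of half-eigenfunctions to the model solution -/

lemma uniqueDiffOn_unitIcc : UniqueDiffOn ℝ (Icc (-1 : ℝ) 1) := uniqueDiffOn_Icc (by norm_num)

lemma dI_eqOn {u f f' : ℝ → ℝ} (hu : EqOn u f (Icc (-1) 1)) (hf : ∀ x, HasDerivAt f (f' x) x) :
    EqOn (dI u) f' (Icc (-1) 1) := fun x hx =>
  (((hf x).hasDerivWithinAt).congr hu (hu hx)).derivWithin (uniqueDiffOn_unitIcc x hx)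

lemma hasDerivAt_dI {u : ℝ → ℝ} (hu : ContDiffOn ℝ 2 u (Icc (-1) 1)) {x : ℝ}
    (hx : x ∈ Ioo (-1 : ℝ) 1) :
    HasDerivAt u (dI u x) x ∧ HasDerivAt (dI u) (dI (dI u) x) x := by
  have hn := Icc_mem_nhds hx.1 hx.2
  have h1 : ContDiffOn ℝ 1 (dI u) (Icc (-1) 1) :=
    hu.derivWithin uniqueDiffOn_unitIcc (by norm_num)
  exact ⟨((hu.differentiableOn (by norm_num)) x
    (Ioo_subset_Icc_self hx)).hasDerivWithinAt.hasDerivAt hn,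
    ((h1.differentiableOn (by norm_num)) x (Ioo_subset_Icc_self hx)).hasDerivWithinAt.hasDerivAt hn⟩

/-- A maximum principle: a function that is convex where it is positive and whose values at the
ends are sub-convex combinations of other values has no positive maximum. -/
lemma MultiPointData.nonpos_of_convex (D : MultiPointData) (hD : D.Admissible)
    {f f₁ f₂ : ℝ → ℝ} (hc : ContinuousOn f (Icc (-1) 1))
    (h1 : ∀ x ∈ Ioo (-1 : ℝ) 1, HasDerivAt f (f₁ x) x)
    (h2 : ∀ x ∈ Ioo (-1 : ℝ) 1, HasDerivAt f₁ (f₂ x) x)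
    (hpos : ∀ x ∈ Ioo (-1 : ℝ) 1, 0 < f x → 0 ≤ f₂ x)
    (hl : f (-1) = ∑ i, D.alphaMinus i * f (D.etaMinus i))
    (hr : f 1 = ∑ i, D.alphaPlus i * f (D.etaPlus i)) : ∀ x ∈ Icc (-1 : ℝ) 1, f x ≤ 0 := by
  by_contra! hcon
  obtain ⟨y, hy, hfy⟩ := hcon
  obtain ⟨z, hz, hmax⟩ := isCompact_Icc.exists_isMaxOn ⟨y, hy⟩ hc
  have hM : 0 < f z := hfy.trans_le (hmax hy)
  have hend : ∀ {m : ℕ} {α η : Fin m → ℝ}, α ∈ coeffSetPlus m → (∀ i, η i ∈ Ioo (-1 : ℝ) 1) →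
      ∑ i, α i * f (η i) < f z := by
    intro m α η hα hη
    have h3 : ∑ i, α i * f (η i) ≤ ∑ i, α i * f z := Finset.sum_le_sum fun i _ =>
      mul_le_mul_of_nonneg_left (hmax (Ioo_subset_Icc_self (hη i))) (hα.2 i)
    rw [← Finset.sum_mul] at h3
    nlinarith [coeffSetPlus.sum_lt_one hα]
  -- At the last maximum point, `f' = 0` and `f'' ≥ 0` just after it, so `f` cannot decrease.
  obtain ⟨x, ⟨hx, hfx⟩, hlast⟩ := (isCompact_Icc.of_isClosed_subset
    (hc.preimage_isClosed_of_isClosed isClosed_Icc (isClosed_singleton (x := f z)))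
    inter_subset_left).exists_isGreatest ⟨z, hz, rfl⟩
  have hfx : f x = f z := hfx
  have hxl : -1 < x := lt_of_le_of_ne hx.1 fun h => by
    rw [← h, hl] at hfx
    exact (hend hD.alphaMinus_mem hD.etaMinus_mem).ne hfx
  have hxr : x < 1 := lt_of_le_of_ne hx.2 fun h => by
    rw [h, hr] at hfx
    exact (hend hD.alphaPlus_mem hD.etaPlus_mem).ne hfx
  have hf1 : f₁ x = 0 := by
    refine IsLocalMax.hasDerivAt_eq_zero ?_ (h1 x ⟨hxl, hxr⟩)
    filter_upwards [Icc_mem_nhds hxl hxr] with t ht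
    rw [hfx]
    exact hmax ht
  obtain ⟨δ, hδ, hδpos⟩ := Metric.eventually_nhds_iff.1
    ((h1 x ⟨hxl, hxr⟩).continuousAt.eventually (lt_mem_nhds (hfx ▸ hM)))
  set y := min (x + δ / 2) ((x + 1) / 2) with hydef
  have hxy : x < y := lt_min (by linarith) (by linarith)
  have hyδ : y ≤ x + δ / 2 := min_le_left _ _
  have hy1 : y < 1 := (min_le_right _ _).trans_lt (by linarith)
  have hylt : f y < f x := by
    refine lt_of_le_of_ne (by rw [hfx]; exact hmax ⟨by linarith, hy1.le⟩) fun h => ?_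
    exact absurd (hlast (show y ∈ Icc (-1 : ℝ) 1 ∩ f ⁻¹' {f z} from
      ⟨⟨by linarith, hy1.le⟩, by simp [h, hfx]⟩)) (not_le.2 hxy)
  obtain ⟨p, hp, hp'⟩ := exists_hasDerivAt_eq_slope f f₁ hxy
    (hc.mono (Icc_subset_Icc hxl.le hy1.le))
    fun t ht => h1 t ⟨by linarith [ht.1], by linarith [ht.2]⟩
  obtain ⟨q, hq, hq'⟩ := exists_hasDerivAt_eq_slope f₁ f₂ hp.1
    (fun t ht =>
      (h2 t ⟨by linarith [ht.1], by linarith [ht.2, hp.2]⟩).continuousAt.continuousWithinAt)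
    fun t ht => h2 t ⟨by linarith [ht.1], by linarith [ht.2, hp.2]⟩
  have h4 : f₁ p < 0 := by
    rw [hp']
    exact div_neg_of_neg_of_pos (by linarith) (by linarith)
  have h5 : f₂ q < 0 := by
    rw [hq', hf1]
    exact div_neg_of_neg_of_pos (by linarith) (by linarith [hp.1])
  have h6 := hpos q ⟨by linarith [hq.1], by linarith [hq.2, hp.2]⟩ (hδpos (by
    rw [Real.dist_eq, abs_of_pos (by linarith [hq.1])]
    linarith [hq.2, hp.2]))
  linarith

lemma MultiPointData.IsHalfEigenfunction.pos {D : MultiPointData} (hD : D.Admissible)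
    {a b lam : ℝ} (ha : 0 < a) (hb : 0 < b) {u : ℝ → ℝ} (hu : D.IsHalfEigenfunction a b lam u) :
    0 < lam := by
  obtain ⟨⟨hC, hl, hr⟩, ⟨x, hx, hne⟩, heq⟩ := hu
  by_contra! hlam
  have h1 := D.nonpos_of_convex hD hC.continuousOn (fun x hx => (hasDerivAt_dI hC hx).1)
    (fun x hx => (hasDerivAt_dI hC hx).2) (fun x hx hp => by
      have := heq x hx
      rw [max_eq_left hp.le, max_eq_right (by linarith)] at this
      nlinarith [mul_pos ha hp]) hl hr
  have h2 := D.nonpos_of_convex hD (f := fun x => -u x) hC.continuousOn.neg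
    (fun x hx => (hasDerivAt_dI hC hx).1.neg)
    (fun x hx => (hasDerivAt_dI hC hx).2.neg) (fun x hx hp => by
      have := heq x hx
      rw [max_eq_left hp.le, max_eq_right (by linarith)] at this
      nlinarith [mul_pos hb hp]) (by simp [hl]) (by simp [hr])
  exact hne (le_antisymm (h1 x hx) (by linarith [h2 x hx]))

/-- Every initial value lies on a rescaling of the model solution. -/
lemma IsHalfWave.exists_scale_phase {a b h : ℝ} {w v : ℝ → ℝ} (H : IsHalfWave a b h w v)
    (ha : 0 < a) (hb : 0 < b) (X Y : ℝ) : ∃ C t, 0 ≤ C ∧ X = C * w t ∧ Y = C * v t := by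
  -- On a half period `w` runs over all values compatible with energy `1`, and the energy
  -- determines `v` up to sign.
  have unit : ∀ X Y : ℝ, Y ^ 2 + a * max X 0 ^ 2 + b * max (-X) 0 ^ 2 = 1 →
      ∃ t, X = w t ∧ Y = v t := by
    intro X Y hXY
    have hwh := H.w_h
    have hw0 := H.w_zero
    have e0 := H.energy 0
    have eh := H.energy h
    rw [max_eq_right hw0.le, max_eq_left (by linarith), H.v_zero] at e0
    rw [max_eq_left hwh.le, max_eq_right (by linarith), H.v_h] at eh
    have hX1 : X ≤ w h := by
      by_contra! hlt
      rw [max_eq_left (by linarith), max_eq_right (by linarith)] at hXY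
      have : w h ^ 2 < X ^ 2 := by gcongr
      nlinarith [sq_nonneg Y, mul_lt_mul_of_pos_left this ha]
    have hX0 : w 0 ≤ X := by
      by_contra! hlt
      rw [max_eq_right (by linarith), max_eq_left (by linarith)] at hXY
      have : (-w 0) ^ 2 < (-X) ^ 2 := by gcongr; linarith
      nlinarith [sq_nonneg Y, mul_lt_mul_of_pos_left this hb]
    have hh := H.h_pos
    have h2h : w (2 * h) = w 0 := by simpa using H.periodic_w 0
    have sq_eq : ∀ t, w t = X → v t ^ 2 = Y ^ 2 := fun t ht => by
      have := H.energy t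
      rw [ht] at this
      linarith
    rcases le_total 0 Y with hY | hY
    · obtain ⟨t, ht, htX⟩ := intermediate_value_Icc hh.le H.continuous_w.continuousOn ⟨hX0, hX1⟩
      refine ⟨t, htX.symm, ?_⟩
      have hv : 0 ≤ v t := by
        rcases ht.1.eq_or_lt with rfl | h1
        · exact H.v_zero.ge
        rcases ht.2.eq_or_lt with rfl | h2
        · exact H.v_h.ge
        exact (H.v_pos t ⟨h1, h2⟩).le
      exact ((sq_eq_sq₀ hv hY).1 (sq_eq t htX)).symm
    · obtain ⟨t, ht, htX⟩ := intermediate_value_Icc' (a := h) (b := 2 * h) (by linarith)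
        H.continuous_w.continuousOn ⟨h2h ▸ hX0, hX1⟩
      refine ⟨t, htX.symm, ?_⟩
      have hv : v t ≤ 0 := by
        rcases ht.1.eq_or_lt with rfl | h1
        · exact H.v_h.le
        rcases ht.2.eq_or_lt with rfl | h2
        · have := H.periodic_v 0
          rw [zero_add, H.v_zero] at this
          exact this.le
        exact (H.v_neg t ⟨h1, h2⟩).le
      have := sq_eq t htX
      rw [sq_eq_sq_iff_abs_eq_abs, abs_of_nonpos hv, abs_of_nonpos hY] at this
      linarith
  set N := Y ^ 2 + a * max X 0 ^ 2 + b * max (-X) 0 ^ 2 with hN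
  have hN0 : 0 ≤ N := by positivity
  rcases hN0.eq_or_lt with h0 | hNpos
  · have hY : Y = 0 := by
      have : 0 ≤ a * max X 0 ^ 2 := by positivity
      have : 0 ≤ b * max (-X) 0 ^ 2 := by positivity
      exact pow_eq_zero_iff (two_ne_zero) |>.1 (by nlinarith [sq_nonneg Y])
    have hX : X = 0 := by
      have h1 : 0 ≤ a * max X 0 ^ 2 := by positivity
      have h2 : 0 ≤ b * max (-X) 0 ^ 2 := by positivity
      have h3 : a * max X 0 ^ 2 = 0 := by nlinarith [sq_nonneg Y]
      have h4 : b * max (-X) 0 ^ 2 = 0 := by nlinarith [sq_nonneg Y]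
      simp only [mul_eq_zero, ha.ne', hb.ne', false_or, pow_eq_zero_iff two_ne_zero] at h3 h4
      exact le_antisymm (by linarith [le_max_left X 0]) (by linarith [le_max_left (-X) 0])
    exact ⟨0, 0, le_rfl, by simp [hX], by simp [hY]⟩
  · set r := √N with hr
    have hrpos : 0 < r := Real.sqrt_pos.2 hNpos
    have hr2 : r ^ 2 = N := Real.sq_sqrt hN0
    obtain ⟨t, h1, h2⟩ := unit (X / r) (Y / r) (by
      rw [show -(X / r) = -X / r by ring, show max (X / r) 0 = max X 0 / r by
        rw [← max_div_div_right hrpos.le, zero_div], show max (-X / r) 0 = max (-X) 0 / r by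
        rw [← max_div_div_right hrpos.le, zero_div]]
      field_simp
      rw [hr2, hN])
    exact ⟨r, t, hrpos.le, by rw [← h1]; field_simp, by rw [← h2]; field_simp⟩

lemma max_mul_zero {C x : ℝ} (hC : 0 ≤ C) : max (C * x) 0 = C * max x 0 := by
  rw [mul_max_of_nonneg _ _ hC, mul_zero]

/-- The rescaled model solution `x ↦ C w (s x + θ)`. -/
def scaledWave (w : ℝ → ℝ) (C s θ x : ℝ) : ℝ := C * w (s * x + θ)

section Scaled

variable {a b h : ℝ} {w v : ℝ → ℝ} {C s θ : ℝ}

lemma IsHalfWave.hasDerivAt_scaledWave (H : IsHalfWave a b h w v) (x : ℝ) :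
    HasDerivAt (scaledWave w C s θ) (C * s * v (s * x + θ)) x := by
  have h1 : HasDerivAt (fun x : ℝ => s * x + θ) s x := by
    simpa using ((hasDerivAt_id x).const_mul s).add_const θ
  have h2 := ((H.hasDerivAt_w _).comp x h1).const_mul C
  rw [show C * s * v (s * x + θ) = C * (v (s * x + θ) * s) by ring]
  exact h2

lemma IsHalfWave.hasDerivAt_deriv_scaledWave (H : IsHalfWave a b h w v) (hC : 0 ≤ C) (x : ℝ) :
    HasDerivAt (fun x => C * s * v (s * x + θ)) (-(s ^ 2 *
      (a * max (scaledWave w C s θ x) 0 - b * max (-(scaledWave w C s θ x)) 0))) x := by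
  have h1 : HasDerivAt (fun x : ℝ => s * x + θ) s x := by
    simpa using ((hasDerivAt_id x).const_mul s).add_const θ
  have h2 := ((H.hasDerivAt_v _).comp x h1).const_mul (C * s)
  rw [scaledWave, show -(C * w (s * x + θ)) = C * -w (s * x + θ) by ring, max_mul_zero hC,
    max_mul_zero hC]
  refine HasDerivAt.congr_deriv h2 ?_
  ring

/-- Any solution of the differential equation with `lam = s ^ 2` is a rescaled model solution, by
uniqueness for the initial value problem at `0`. -/
lemma IsHalfWave.exists_eqOn_scaledWave (H : IsHalfWave a b h w v) (ha : 0 < a) (hb : 0 < b)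
    (hs : 0 < s) {u : ℝ → ℝ} (hu : ContDiffOn ℝ 2 u (Icc (-1) 1))
    (heq : ∀ x ∈ Ioo (-1 : ℝ) 1, -(dI (dI u) x) = s ^ 2 * (a * max (u x) 0 - b * max (-(u x)) 0)) :
    ∃ C θ, 0 ≤ C ∧ EqOn u (scaledWave w C s θ) (Icc (-1) 1) := by
  obtain ⟨C, θ, hC, hX, hY⟩ := H.exists_scale_phase ha hb (u 0) (dI u 0 / s)
  refine ⟨C, θ, hC, ?_⟩
  set F : ℝ → ℝ := fun x => -(s ^ 2 * (a * max x 0 - b * max (-x) 0)) with hF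
  have hFL : LipschitzWith (Real.toNNReal (s ^ 2 * (a + b))) F := by
    refine LipschitzWith.of_dist_le_mul fun x y => ?_
    rw [Real.coe_toNNReal _ (by positivity), Real.dist_eq, Real.dist_eq]
    have e : F x - F y = s ^ 2 *
        (b * (max (-x) 0 - max (-y) 0) - a * (max x 0 - max y 0)) := by
      simp only [hF]; ring
    have h1 : |max x 0 - max y 0| ≤ |x - y| := abs_max_sub_max_le_abs _ _ _
    have h2 : |max (-x) 0 - max (-y) 0| ≤ |x - y| :=
      (abs_max_sub_max_le_abs _ _ _).trans_eq (by rw [← abs_neg]; congr 1; ring)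
    rw [e, abs_mul, abs_of_pos (by positivity : (0 : ℝ) < s ^ 2), mul_assoc]
    refine mul_le_mul_of_nonneg_left ((abs_sub _ _).trans ?_) (by positivity)
    rw [abs_mul, abs_mul, abs_of_pos ha, abs_of_pos hb]
    nlinarith
  have hvf : LipschitzWith (max 1 (Real.toNNReal (s ^ 2 * (a + b)) * 1))
      fun y : ℝ × ℝ => (y.2, F y.1) :=
    LipschitzWith.prod_snd.prodMk (hFL.comp LipschitzWith.prod_fst)
  have hmain : EqOn (fun x => (u x, dI u x))
      (fun x => (scaledWave w C s θ x, C * s * v (s * x + θ))) (Ioo (-1) 1) := by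
    refine ODE_solution_unique_of_mem_Ioo (v := fun _ y => (y.2, F y.1)) (s := fun _ => univ)
      (t₀ := 0) (fun t _ => hvf.lipschitzOnWith) (by simp) (fun t ht => ⟨?_, mem_univ _⟩)
      (fun t ht => ⟨?_, mem_univ _⟩) ?_
    · have h1 := hasDerivAt_dI hu ht
      have h2 := heq t ht
      rw [show dI (dI u) t = F (u t) by simp only [hF]; linarith] at h1
      exact h1.1.prodMk h1.2
    · exact (H.hasDerivAt_scaledWave t).prodMk (H.hasDerivAt_deriv_scaledWave hC t)
    · have h3 : dI u 0 = C * s * v θ := by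
        rw [div_eq_iff hs.ne'] at hY
        rw [hY]; ring
      simp [scaledWave, hX, h3]
  have hcl : closure (Ioo (-1 : ℝ) 1) = Icc (-1) 1 := closure_Ioo (by norm_num)
  refine EqOn.of_subset_closure (s := Ioo (-1) 1) (fun x hx => congrArg Prod.fst (hmain hx))
    hu.continuousOn ?_ Ioo_subset_Icc_self hcl.ge
  exact fun x _ => (H.hasDerivAt_scaledWave x).continuousAt.continuousWithinAt

lemma IsHalfWave.contDiff_scaledWave (H : IsHalfWave a b h w v) :
    ContDiff ℝ 2 (scaledWave w C s θ) := by
  have hw : deriv w = v := funext fun t => (H.hasDerivAt_w t).deriv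
  have hv : deriv v = fun t => -(a * max (w t) 0 - b * max (-(w t)) 0) :=
    funext fun t => (H.hasDerivAt_v t).deriv
  have hc := H.continuous_w
  have h1 : ContDiff ℝ 1 v := contDiff_one_iff_deriv.2
    ⟨fun t => (H.hasDerivAt_v t).differentiableAt, by rw [hv]; fun_prop⟩
  have h2 : ContDiff ℝ (1 + 1) w := contDiff_succ_iff_deriv.2
    ⟨fun t => (H.hasDerivAt_w t).differentiableAt, by simp, by rwa [hw]⟩
  rw [one_add_one_eq_two] at h2
  unfold scaledWave
  fun_prop

end Scaled

/-! ### Nodal classes and the spectrum -/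

lemma MultiPointData.T.unique {D : MultiPointData} {k k' : ℕ} {ν ν' : ℤˣ} {u : ℝ → ℝ}
    (h : D.T k ν u) (h' : D.T k' ν' u) : k = k' ∧ ν = ν' := by
  refine ⟨?_, ?_⟩
  · have := h.deriv_zeros_card.symm.trans h'.deriv_zeros_card
    exact_mod_cast this
  · have h1 := h.deriv_left_sign
    have h2 := h'.deriv_left_sign
    rcases Int.units_eq_one_or ν with rfl | rfl <;> rcases Int.units_eq_one_or ν' with rfl | rfl <;>
      first
      | rfl
      | (norm_num at h1 h2; linarith)

section Spectrum

variable {a b h : ℝ} {w v : ℝ → ℝ} {D : MultiPointData} {C s θ : ℝ} {i j : ℤ} {u : ℝ → ℝ}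

lemma IsHalfWave.dI_eqOn (H : IsHalfWave a b h w v)
    (hu : EqOn u (scaledWave w C s θ) (Icc (-1) 1)) :
    EqOn (dI u) (fun x => C * s * v (s * x + θ)) (Icc (-1) 1) :=
  _root_.dI_eqOn hu fun x => H.hasDerivAt_scaledWave x

lemma IsHalfWave.dI_dI_eqOn (H : IsHalfWave a b h w v) (hC : 0 ≤ C)
    (hu : EqOn u (scaledWave w C s θ) (Icc (-1) 1)) :
    EqOn (dI (dI u)) (fun x => -(s ^ 2 *
      (a * max (scaledWave w C s θ x) 0 - b * max (-(scaledWave w C s θ x)) 0))) (Icc (-1) 1) :=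
  _root_.dI_eqOn (H.dI_eqOn hu) fun x => H.hasDerivAt_deriv_scaledWave hC x

/-- The zeros of the derivative of a rescaled model solution in `(-1, 1)` correspond to the
critical points of `w` between its end phases. -/
lemma IsHalfWave.mem_deriv_zeros_iff (H : IsHalfWave a b h w v) (hC : 0 < C) (hs : 0 < s)
    (hp : D.IsPair w h i j s θ) (hu : EqOn u (scaledWave w C s θ) (Icc (-1) 1)) (x : ℝ) :
    x ∈ Ioo (-1 : ℝ) 1 ∧ dI u x = 0 ↔ ∃ m ∈ Ioc i j, s * x + θ = m * h := by
  have hh := H.h_pos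
  constructor
  · rintro ⟨hx, h0⟩
    rw [H.dI_eqOn hu (Ioo_subset_Icc_self hx)] at h0
    simp only [mul_eq_zero, hC.ne', hs.ne', false_or] at h0
    obtain ⟨m, hm⟩ := (H.v_eq_zero_iff _).1 h0
    refine ⟨m, ⟨?_, ?_⟩, hm⟩
    · have : (i : ℝ) < m := lt_of_mul_lt_mul_right
        (by nlinarith [hp.left_mem.1, mul_lt_mul_of_pos_left hx.1 hs]) hh.le
      exact_mod_cast this
    · have : (m : ℝ) < j + 1 := lt_of_mul_lt_mul_right
        (by nlinarith [hp.right_mem.2, mul_lt_mul_of_pos_left hx.2 hs]) hh.le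
      exact Int.lt_add_one_iff.1 (by exact_mod_cast this)
  · rintro ⟨m, ⟨h1, h2⟩, hm⟩
    have h3 : (i : ℝ) + 1 ≤ m := by exact_mod_cast h1
    have h4 : (m : ℝ) ≤ j := by exact_mod_cast h2
    have hx : x ∈ Ioo (-1 : ℝ) 1 := by
      constructor
      · refine lt_of_mul_lt_mul_left (a := s) ?_ hs.le
        nlinarith [hp.left_mem.2, mul_le_mul_of_nonneg_right h3 hh.le]
      · refine lt_of_mul_lt_mul_left (a := s) ?_ hs.le
        nlinarith [hp.right_mem.1, mul_le_mul_of_nonneg_right h4 hh.le]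
    refine ⟨hx, ?_⟩
    rw [H.dI_eqOn hu (Ioo_subset_Icc_self hx)]
    simp only [hm, H.v_int_mul, mul_zero]

/-- The arcs containing the end phases determine the nodal class. -/
lemma IsHalfWave.mem_T (H : IsHalfWave a b h w v) (ha : 0 < a) (hb : 0 < b) (hC : 0 < C)
    (hs : 0 < s) (hp : D.IsPair w h i j s θ)
    (huX : u ∈ D.X) (hu : EqOn u (scaledWave w C s θ) (Icc (-1) 1)) :
    D.T (j - i).toNat i.negOnePow u := by
  have hz := H.mem_deriv_zeros_iff hC hs hp hu
  have hl : (-1 : ℝ) ∈ Icc (-1 : ℝ) 1 := by norm_num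
  have hr : (1 : ℝ) ∈ Icc (-1 : ℝ) 1 := by norm_num
  have hCs : 0 < C * s := mul_pos hC hs
  refine ⟨huX, ?_, ?_, ?_, ?_, ?_⟩
  · rw [H.dI_eqOn hu hr]
    have := H.sign_v_pos hp.right_mem
    rw [add_comm, ← mul_one s] at this
    exact mul_ne_zero hCs.ne' (right_ne_zero_of_mul this.ne')
  · rw [H.dI_eqOn hu hl]
    have := H.sign_v_pos hp.left_mem
    have e : s * -1 + θ = θ - s := by ring
    simp only [e]
    have := mul_pos hCs this
    rw [realSign] at this
    linarith
  · intro x hx h0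
    obtain ⟨m, -, hm⟩ := (hz x).1 ⟨hx, h0⟩
    rw [H.dI_dI_eqOn hC.le hu (Ioo_subset_Icc_self hx)]
    simp only [scaledWave, hm]
    have hw : w (m * h) ≠ 0 := right_ne_zero_of_mul (H.sign_w_int_mul m).ne
    refine neg_ne_zero.2 (mul_ne_zero (by positivity) ?_)
    rcases hw.lt_or_gt with hw | hw
    · have := mul_neg_of_pos_of_neg hC hw
      rw [max_eq_right this.le, max_eq_left (by linarith)]
      nlinarith
    · have := mul_pos hC hw
      rw [max_eq_left this.le, max_eq_right (by linarith)]
      nlinarith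
  · have hset : {x ∈ Ioo (-1 : ℝ) 1 | dI u x = 0} =
        (fun m : ℤ => ((m : ℝ) * h - θ) / s) '' (Finset.Ioc i j : Set ℤ) := by
      ext x
      rw [mem_ofPred_eq, hz x, Finset.coe_Ioc]
      constructor
      · rintro ⟨m, hm, e⟩
        exact ⟨m, hm, by simp only [← e]; field_simp; ring⟩
      · rintro ⟨m, hm, rfl⟩
        exact ⟨m, hm, by field_simp; ring⟩
    rw [hset, InjOn.encard_image, encard_coe_eq_coe_finsetCard, Int.card_Ioc]
    intro m _ n _ hmn
    have h1 : (m : ℝ) * h - θ = n * h - θ := (div_left_inj' hs.ne').1 hmn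
    have h2 : (m : ℝ) = n := mul_right_cancel₀ H.h_pos.ne' (by linarith)
    exact_mod_cast h2
  · intro x hx y hy hxy hx0 hy0 hno
    obtain ⟨m, hm, hmx⟩ := (hz x).1 ⟨hx, hx0⟩
    obtain ⟨n, hn, hny⟩ := (hz y).1 ⟨hy, hy0⟩
    have hh := H.h_pos
    have hlt := mul_lt_mul_of_pos_left hxy hs
    have hmn : (m : ℝ) < n := lt_of_mul_lt_mul_right (by linarith) hh.le
    have hmn' : m + 1 ≤ n := by exact_mod_cast hmn
    have hmn1 : m + 1 = n := by
      refine hmn'.eq_of_not_lt fun hlt' => ?_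
      have h' : ((m + 1 : ℤ) : ℝ) < n := by exact_mod_cast hlt'
      have h3 := mul_lt_mul_of_pos_right h' hh
      have h4 : (m : ℝ) * h < ((m + 1 : ℤ) : ℝ) * h := by push_cast; linarith
      refine hno ((((m + 1 : ℤ) : ℝ) * h - θ) / s) ⟨?_, ?_⟩ ?_
      · rw [lt_div_iff₀ hs]; linarith
      · rw [div_lt_iff₀ hs]; linarith
      · exact ((hz _).2 ⟨m + 1, ⟨by have := hm.1; omega, by have := hn.2; omega⟩,
          by field_simp; ring⟩).2
    obtain ⟨t, ht, ht0⟩ := H.exists_zero_mem_arc m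
    have e : ((m : ℝ) + 1) * h = n * h := by rw [← hmn1]; push_cast; ring
    have ht2 := ht.2
    rw [e] at ht2
    have hzm : (t - θ) / s ∈ Ioo x y := by
      constructor
      · rw [lt_div_iff₀ hs]; linarith [ht.1]
      · rw [div_lt_iff₀ hs]; linarith
    refine ⟨(t - θ) / s, hzm, ?_⟩
    rw [hu ⟨by linarith [hx.1, hzm.1], by linarith [hy.2, hzm.2]⟩, scaledWave,
      show s * ((t - θ) / s) + θ = t by field_simp; ring, ht0, mul_zero]

lemma IsHalfWave.isHalfEigenfunction_scaledWave (H : IsHalfWave a b h w v) (hs : 0 < s)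
    (hp : D.IsPair w h i j s θ) :
    D.IsHalfEigenfunction a b (s ^ 2) (scaledWave w 1 s θ) := by
  have e1 : s * -1 + θ = θ - s := by ring
  have e2 : s * 1 + θ = θ + s := by ring
  refine ⟨⟨H.contDiff_scaledWave.contDiffOn, ?_, ?_⟩, ?_, fun x hx => ?_⟩
  · have := hp.left_eq
    simp only [bdefect, sub_eq_zero] at this
    simpa only [scaledWave, one_mul, e1, add_comm _ θ] using this
  · have := hp.right_eq
    simp only [bdefect, sub_eq_zero] at this
    simpa only [scaledWave, one_mul, e2, add_comm _ θ] using this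
  · -- The slope does not vanish at `-1`, so the function is not identically zero.
    by_contra! hcon
    have h0 : EqOn (scaledWave w 1 s θ) (fun _ => 0) (Icc (-1) 1) := hcon
    have hl : (-1 : ℝ) ∈ Icc (-1 : ℝ) 1 := by norm_num
    have h1 := _root_.dI_eqOn h0 (fun x => hasDerivAt_const x (0 : ℝ)) hl
    rw [H.dI_eqOn (fun x _ => rfl) hl] at h1
    have h2 := H.sign_v_pos hp.left_mem
    simp only [e1, one_mul, mul_eq_zero, hs.ne', false_or] at h1
    rw [h1, mul_zero] at h2
    exact lt_irrefl _ h2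
  · rw [H.dI_dI_eqOn zero_le_one (fun x _ => rfl) (Ioo_subset_Icc_self hx), neg_neg]

/-- Every half-eigenfunction is a rescaled model solution, with end phases in two distinct arcs. -/
lemma IsHalfWave.exists_pair_of_isHalfEigenfunction (H : IsHalfWave a b h w v)
    (hD : D.Admissible) (ha : 0 < a) (hb : 0 < b) {lam : ℝ}
    (hu : D.IsHalfEigenfunction a b lam u) :
    ∃ C s θ i j, 0 < C ∧ 0 < s ∧ lam = s ^ 2 ∧ i < j ∧ D.IsPair w h i j s θ ∧
      EqOn u (scaledWave w C s θ) (Icc (-1) 1) := by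
  have hlam := hu.pos hD ha hb
  obtain ⟨⟨hu2, hl, hr⟩, ⟨x, hx, hne⟩, heq⟩ := hu
  obtain ⟨s, hs, rfl⟩ : ∃ s : ℝ, 0 < s ∧ lam = s ^ 2 :=
    ⟨√lam, Real.sqrt_pos.2 hlam, (Real.sq_sqrt hlam.le).symm⟩
  obtain ⟨C, θ, hC, hE⟩ := H.exists_eqOn_scaledWave ha hb hs hu2 heq
  have hC' : C ≠ 0 := by
    rintro rfl
    exact hne (by simp [hE hx, scaledWave])
  have hCpos : 0 < C := lt_of_le_of_ne hC hC'.symm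
  have e1 : s * -1 + θ = θ - s := by ring
  have e2 : s * 1 + θ = θ + s := by ring
  -- Dividing the boundary conditions of `u` by `C` gives those of `w`.
  have bc : ∀ {m : ℕ} {α η : Fin m → ℝ} {e : ℝ}, e ∈ Icc (-1 : ℝ) 1 →
      (∀ k, η k ∈ Ioo (-1 : ℝ) 1) → u e = ∑ k, α k * u (η k) →
      bdefect w α (s * e + θ) (fun k => θ + s * η k) = 0 := by
    intro m α η e he hη hue
    rw [hE he, Finset.sum_congr rfl fun k _ => by rw [hE (Ioo_subset_Icc_self (hη k))]] at hue
    simp only [scaledWave, mul_left_comm _ C, ← Finset.mul_sum] at hue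
    rw [bdefect, sub_eq_zero, mul_left_cancel₀ hC' hue]
    exact Finset.sum_congr rfl fun k _ => by rw [add_comm]
  have hL := bc (by norm_num) hD.etaMinus_mem hl
  have hR := bc (by norm_num) hD.etaPlus_mem hr
  rw [e1] at hL
  rw [e2] at hR
  -- A boundary condition cannot hold at a critical point, so the end phases lie in arcs.
  have inArc : ∀ {m : ℕ} {α η : Fin m → ℝ} {e : ℝ}, α ∈ coeffSetPlus m →
      bdefect w α e η = 0 → ∃ i, e ∈ arc h i := by
    intro m α η e hα h0
    obtain ⟨i, hi | hi⟩ := H.eq_int_mul_or_mem_arc e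
    · have := H.sign_bdefect_neg ha hb hα.2 (coeffSetPlus.sum_lt_one hα) i η
      rw [← hi, h0, mul_zero] at this
      exact absurd this (lt_irrefl _)
    · exact ⟨i, hi⟩
  obtain ⟨i, hi⟩ := inArc hD.alphaMinus_mem hL
  obtain ⟨j, hj⟩ := inArc hD.alphaPlus_mem hR
  have hp : D.IsPair w h i j s θ := ⟨hi, hj, hL, hR⟩
  exact ⟨C, s, θ, i, j, hCpos, hs, rfl, hp.lt H hD ha hb hs, hp, hE⟩

/-- With a single critical point inside, the signed function is smallest at an end point, and
there the boundary condition makes it nonnegative. -/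
lemma IsHalfWave.sign_w_pos_of_adjacent (H : IsHalfWave a b h w v) (hD : D.Admissible)
    (hp : D.IsPair w h i (i + 1) s θ) (hs : 0 < s) {t : ℝ} (ht : t ∈ Ioo (θ - s) (θ + s)) :
    0 < realSign i * w t := by
  set f : ℝ → ℝ := fun t => realSign i * w t with hf
  have hfc : Continuous f := continuous_const.mul H.continuous_w
  have hfd : ∀ t, deriv f t = realSign i * v t := fun t => ((H.hasDerivAt_w t).const_mul _).deriv
  have h1 := hp.left_mem
  have h2 := hp.right_mem
  set m := ((i : ℝ) + 1) * h with hm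
  have h2l : m < θ + s := by have := h2.1; push_cast at this; exact this
  have hup : StrictMonoOn f (Icc (θ - s) m) := by
    refine strictMonoOn_of_deriv_pos (convex_Icc _ _) hfc.continuousOn fun t ht => ?_
    rw [interior_Icc] at ht
    rw [hfd]
    exact H.sign_v_pos ⟨h1.1.trans ht.1, ht.2⟩
  have hdown : StrictAntiOn f (Icc m (θ + s)) := by
    refine strictAntiOn_of_deriv_neg (convex_Icc _ _) hfc.continuousOn fun t ht => ?_
    rw [interior_Icc] at ht
    rw [hfd]
    have := H.sign_v_pos (i := i + 1) (t := t) ⟨by push_cast; exact ht.1, ht.2.trans h2.2⟩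
    rw [realSign_succ] at this
    linarith
  have hlt : ∀ t ∈ Ioo (θ - s) (θ + s), min (f (θ - s)) (f (θ + s)) < f t := by
    intro t ht
    rcases le_total t m with h | h
    · exact (min_le_left _ _).trans_lt
        (hup ⟨le_rfl, h1.2.le⟩ ⟨ht.1.le, h⟩ ht.1)
    · exact (min_le_right _ _).trans_lt
        (hdown ⟨h, ht.2.le⟩ ⟨h2l.le, le_rfl⟩ ht.2)
  refine lt_of_le_of_lt ?_ (hlt t ht)
  have bc : ∀ {m : ℕ} {α η : Fin m → ℝ} {e : ℝ}, α ∈ coeffSetPlus m →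
      (∀ k, η k ∈ Ioo (-1 : ℝ) 1) → bdefect w α e (fun k => θ + s * η k) = 0 →
      f e = min (f (θ - s)) (f (θ + s)) → 0 ≤ f e := by
    intro m α η e hα hη h0 hmin
    have h3 : ∑ k, α k * f e ≤ ∑ k, α k * f (θ + s * η k) :=
      Finset.sum_le_sum fun k _ => mul_le_mul_of_nonneg_left (by
        rw [hmin]
        exact (hlt _ ⟨by nlinarith [(hη k).1], by nlinarith [(hη k).2]⟩).le) (hα.2 k)
    have h4 : ∑ k, α k * f (θ + s * η k) = f e := by
      simp only [hf, mul_left_comm _ (realSign i), ← Finset.mul_sum]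
      rw [← sub_eq_zero.1 h0]
    rw [← Finset.sum_mul, h4] at h3
    nlinarith [coeffSetPlus.sum_lt_one hα]
  rcases min_choice (f (θ - s)) (f (θ + s)) with h | h
  · rw [h]
    exact bc hD.alphaMinus_mem hD.etaMinus_mem hp.left_eq h.symm
  · rw [h]
    exact bc hD.alphaPlus_mem hD.etaPlus_mem hp.right_eq h.symm

end Spectrum

/-- The number in `{0, 1}` of an arc on which the model solution has slope of sign `ν`. -/
def arcOfSign (ν : ℤˣ) : ℤ := if ν = 1 then 0 else 1

lemma negOnePow_arcOfSign (ν : ℤˣ) : (arcOfSign ν).negOnePow = ν := by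
  rcases Int.units_eq_one_or ν with rfl | rfl <;> simp [arcOfSign]

lemma exists_eq_arcOfSign_add (i : ℤ) : ∃ n : ℤ, i = arcOfSign i.negOnePow + 2 * n := by
  obtain ⟨n, rfl | rfl⟩ := Int.even_or_odd' i
  · exact ⟨n, by simp [arcOfSign, Int.negOnePow_even _ (even_two_mul n)]⟩
  · exact ⟨n, by simp [arcOfSign, Int.negOnePow_odd _ (odd_two_mul_add_one n)]; ring⟩

theorem mainTheorem1 (D : MultiPointData) (hD : D.Admissible)
    (a b : ℝ) (ha : 0 < a) (hb : 0 < b) :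
    ∃ lam : ℕ → ℤˣ → ℝ,
      -- `lam k ν > 0` is the only half-eigenvalue with a half-eigenfunction in `T_{k,ν}`
      (∀ k : ℕ, 1 ≤ k → ∀ ν : ℤˣ,
        0 < lam k ν ∧
        (∃ φ, D.IsHalfEigenfunction a b (lam k ν) φ ∧ D.T k ν φ) ∧
        ∀ μ : ℝ, (∃ φ, D.IsHalfEigenfunction a b μ φ ∧ D.T k ν φ) → μ = lam k ν) ∧
      -- there are no other half-eigenvalues
      (∀ μ : ℝ, D.IsHalfEigenvalue a b μ → ∃ k : ℕ, 1 ≤ k ∧ ∃ ν : ℤˣ, μ = lam k ν) ∧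
      -- monotonicity
      (∀ k k' : ℕ, 1 ≤ k → k < k' → ∀ ν ν' : ℤˣ, lam k ν < lam k' ν') ∧
      -- `±φ_{1,±}` is strictly positive on `(-1,1)`
      (∀ (ν : ℤˣ) (φ : ℝ → ℝ), D.IsHalfEigenfunction a b (lam 1 ν) φ → D.T 1 ν φ →
        ∀ x ∈ Ioo (-1 : ℝ) 1, 0 < ((ν : ℤ) : ℝ) * φ x) ∧
      -- divergence
      (∀ ν : ℤˣ, Tendsto (fun k => lam k ν) atTop atTop) := by
  obtain ⟨h, w, v, H⟩ := exists_isHalfWave ha hb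
  have hex : ∀ (k : ℕ) (ν : ℤˣ), ∃ s θ, 1 ≤ k →
      0 < s ∧ D.IsPair w h (arcOfSign ν) (arcOfSign ν + k) s θ := by
    intro k ν
    by_cases hk : 1 ≤ k
    · obtain ⟨s, θ, hs⟩ := H.exists_pair hD ha hb
        (show arcOfSign ν < arcOfSign ν + k by omega)
      exact ⟨s, θ, fun _ => hs⟩
    · exact ⟨0, 0, fun h => absurd h hk⟩
  choose S Θ hS using hex
  -- The frequency depends only on the number of arcs spanned and on the parity of the first one.
  have huniq : ∀ {i j : ℤ} {s θ : ℝ} (k : ℕ), 1 ≤ k → j = i + k → D.IsPair w h i j s θ →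
      s = S k i.negOnePow := by
    rintro i _ s θ k hk rfl hp
    obtain ⟨n, hn⟩ := exists_eq_arcOfSign_add i
    have hp' := (hS k i.negOnePow hk).2.shift H n
    rw [show arcOfSign i.negOnePow + k + 2 * n = i + k by omega, ← hn] at hp'
    rcases le_total s (S k i.negOnePow) with hle | hle
    · exact (H.pair_rigid hD ha hb hp' hp le_rfl le_rfl hle).2.2
    · exact (H.pair_rigid hD ha hb hp hp' le_rfl le_rfl hle).2.2.symm
  have hchar : ∀ {μ : ℝ} {u : ℝ → ℝ}, D.IsHalfEigenfunction a b μ u →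
      ∃ C s θ i k, 0 < C ∧ 0 < s ∧ μ = s ^ 2 ∧ 1 ≤ k ∧ D.IsPair w h i (i + (k : ℕ)) s θ ∧
        EqOn u (scaledWave w C s θ) (Icc (-1) 1) ∧ D.T k i.negOnePow u := by
    intro μ u hu
    obtain ⟨C, s, θ, i, j, hC, hs, hμ, hij, hp, hE⟩ :=
      H.exists_pair_of_isHalfEigenfunction hD ha hb hu
    have hT := H.mem_T ha hb hC hs hp hu.1 hE
    refine ⟨C, s, θ, i, (j - i).toNat, hC, hs, hμ, by omega, ?_, hE, hT⟩
    rwa [show i + ((j - i).toNat : ℤ) = j by omega]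
  refine ⟨fun k ν => S k ν ^ 2, fun k hk ν => ⟨?_, ?_, ?_⟩, ?_, ?_, ?_, ?_⟩
  · have := (hS k ν hk).1
    positivity
  · obtain ⟨hs, hp⟩ := hS k ν hk
    have hu := H.isHalfEigenfunction_scaledWave hs hp
    refine ⟨_, hu, ?_⟩
    have hT := H.mem_T ha hb one_pos hs hp hu.1 (fun x _ => rfl)
    rwa [negOnePow_arcOfSign, add_sub_cancel_left, Int.toNat_natCast] at hT
  · rintro μ ⟨φ, hφ, hT⟩
    obtain ⟨C, s, θ, i, k', -, -, rfl, hk', hp, -, hT'⟩ := hchar hφ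
    obtain ⟨rfl, rfl⟩ := hT.unique hT'
    simp only [huniq k hk rfl hp]
  · rintro μ ⟨φ, hφ⟩
    obtain ⟨C, s, θ, i, k, -, -, rfl, hk, hp, -, -⟩ := hchar hφ
    exact ⟨k, hk, i.negOnePow, by simp only [huniq k hk rfl hp]⟩
  · intro k k' hk hkk' ν ν'
    obtain ⟨hs, hp⟩ := hS k ν hk
    obtain ⟨hs', hp'⟩ := hS k' ν' (by omega)
    -- Shift the second range of arcs so that it contains the first one.
    obtain ⟨n, hn1, hn2⟩ : ∃ n : ℤ, arcOfSign ν' + 2 * n ≤ arcOfSign ν ∧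
        arcOfSign ν ≤ arcOfSign ν' + 2 * n + 1 := by
      refine ⟨(arcOfSign ν - arcOfSign ν') / 2, ?_, ?_⟩ <;> omega
    have hlt : S k ν < S k' ν' := by
      by_contra! hle
      have := H.pair_rigid hD ha hb hp (hp'.shift H n) hn1 (by omega) hle
      omega
    exact pow_lt_pow_left₀ hlt hs.le two_ne_zero
  · intro ν φ hφ hT x hx
    obtain ⟨C, s, θ, i, k, hC, hs, -, hk, hp, hE, hT'⟩ := hchar hφ
    obtain ⟨rfl, rfl⟩ := hT.unique hT'
    have := H.sign_w_pos_of_adjacent hD hp hs (t := s * x + θ)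
      ⟨by nlinarith [hx.1], by nlinarith [hx.2]⟩
    have := mul_pos hC this
    rw [hE (Ioo_subset_Icc_self hx), scaledWave]
    rw [realSign] at this
    linarith
  · intro ν
    have hh := H.h_pos
    have hbound : ∀ k : ℕ, 1 ≤ k → ((k : ℝ) - 1) * h / 2 ≤ S k ν := by
      intro k hk
      have hp := (hS k ν hk).2
      have h1 := hp.left_mem.2
      have h2 := hp.right_mem.1
      push_cast at h2
      linarith
    have hlin : Tendsto (fun k : ℕ => ((k : ℝ) - 1) * h / 2) atTop atTop :=
      ((tendsto_atTop_add_const_right _ (-1) tendsto_natCast_atTop_atTop).atTop_mul_const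
        hh).atTop_div_const two_pos
    have hStop : Tendsto (fun k => S k ν) atTop atTop :=
      tendsto_atTop_mono' _ (eventually_atTop.2 ⟨1, hbound⟩) hlin
    exact (tendsto_pow_atTop two_ne_zero).comp hStop
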